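/- **Setting.** Let $f_0,f_1$ be probability densities with respect to a $\sigma$-finite measure $\nu$ whose Kullback–Leibler divergences $I_0=\int\log(f_0/f_1)f_0\,d\nu$ and $I_1=\int\log(f_1/f_0)f_1\,d\nu$ are positive and finite. Let $X_1,X_2,\dots$ be i.i.d. with density $f_i$ under $\mathsf P_i$ ($i\in\{0,1\}$), $\mathcal F_n=\sigma(X_1,\dots,X_n)$, $\Lambda_n=\sum_{k=1}^n\log\frac{f_1(X_k)}{f_0(X_k)}$ and $\bar\Lambda_n=\Lambda_n/n$. A test is a pair $(T,D)$, where $T\ge1$ is an $(\mathcal F_n)$-stopping time, finite a.s. under $\mathsf P_0$ and $\mathsf P_1$, and $D\in\{0,1\}$ is $\mathcal F_T$-measurable; $D=1$ means that $H_0\colon f=f_0$ is rejected in favour of $H_1\colon f=f_1$. For $\alpha,\beta\in(0,1)$ let $\mathcal E(\alpha,\beta)$ be the set of tests with $\mathsf P_0(D=1)\le\alpha$ and $\mathsf P_1(D=0)\le\beta$. For $\pi\in[0,1]$ let $\mathsf E_\pi$ be the expectation under $(1-\pi)\mathsf P_0+\pi\mathsf P_1$ and $\mathcal L_\pi(\alpha,\beta)=\inf_{(T,D)\in\mathcal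 E(\alpha,\beta)}\mathsf E_\pi[T]$. **Many streams.** For each $m\ge1$ consider $m$ independent streams, i.i.d. with density $f_1$ for streams in the set of signals $\mathcal A\subseteq\{1,\dots,m\}$ and $f_0$ for the others; write $\mathsf P_{\mathcal A}$ for the law. The same test $(T,D)$ is applied to each stream $j$, giving $(T^j,D^j)$. Let $0\le l_m\le u_m\le m$, $u_m>0$, $l_m<m$, and let $\mathcal E_m(\alpha,\beta)$ be the set of tests such that $\mathsf P_{\mathcal A}(\exists j\notin\mathcal A: D^j=1)\le\alpha$ and $\mathsf P_{\mathcal A}(\exists j\in\mathcal A: D^j=0)\le\beta$ for all $\mathcal A$ with $l_m\le|\mathcal A|\le u_m$. Put $\alpha_m=1-(1-\alpha)^{1/(m-l_m)}$ and $\beta_m=1-(1-\beta)^{1/u_m}$. A family $\chi^*=\{(T^*(\alpha,\beta),D^*(\alpha,\beta)):\alpha,\beta\in(0,1)\}$ is *asymptotically optimal in the high-dimensional sense* if $(T^*(\alpha,\beta),D^*(\alpha,\beta))\in\mathcal E(\alpha,\beta)$ for all $\alpha,\beta\in(0,1)$ and, for all $\alpha,\beta\in(0,1)$, $$\max_{l_m\le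 s\le u_m}\frac{\mathsf E_{s/m}[T^*(\alpha_m,\beta_m)]}{\mathcal L_{s/m}(\alpha_m,\beta_m)}\longrightarrow1\qquad(m\to\infty).$$ **SPRTs.** For $\alpha,\beta\in(0,1)$, $\widetilde T(\alpha,\beta)=\inf\{n\ge1:\Lambda_n\notin(-|\log\beta|,|\log\alpha|)\}$ and $\widetilde D(\alpha,\beta)=1\{\Lambda_{\widetilde T}\ge|\log\alpha|\}$. **GMTs.** Let $n^*(a,b)$ be the least $n\ge1$ such that $\mathsf P_0(\bar\Lambda_n>c)\le a$ and $\mathsf P_1(\bar\Lambda_n\le c)\le b$ for some $c\in\mathbb R$, let $c^*(a,b)$ be the least such $c$ for $n=n^*(a,b)$, and let $\mathsf{FSST}(a,b)=(n^*(a,b),c^*(a,b))$. Given $\alpha,\beta\in(0,1)$, put $(N,C)=\mathsf{FSST}(\alpha/4,\beta/4)$, $$K_0=\max\{j\ge0: n^*((\beta/4)^j,(\beta/4)^j)\le N,\ (\beta/4)^j\ge3\alpha/4\},\qquad K_1=\max\{j\ge0: n^*((\alpha/4)^j,(\alpha/4)^j)\le N,\ (\alpha/4)^j\ge3\beta/4\},$$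 and, with free parameters $\gamma_0\in(\max(3\alpha,\beta)/4,1)$ and $\gamma_1\in(\max(\alpha,3\beta)/4,1)$, $$(N_{0,0},C_{0,0})=\mathsf{FSST}\Big(\gamma_0,\tfrac{3\beta}4-\sum_{j=1}^{K_0}(\tfrac\beta4)^j\Big),\qquad (N_{1,0},C_{1,0})=\mathsf{FSST}\Big(\tfrac{3\alpha}4-\sum_{j=1}^{K_1}(\tfrac\alpha4)^j,\gamma_1\Big),$$ $(N_{0,j},C_{0,j})=\mathsf{FSST}((\beta/4)^j,(\beta/4)^j)$ for $1\le j\le K_0$, and $(N_{1,j},C_{1,j})=\mathsf{FSST}((\alpha/4)^j,(\alpha/4)^j)$ for $1\le j\le K_1$. The GMT $(\widehat T(\alpha,\beta),\widehat D(\alpha,\beta))$ stops at the first of the following occasions: after $N_{0,j}<N$ observations with $\bar\Lambda_{N_{0,j}}\le C_{0,j}$, for some $0\le j\le K_0$, accepting $H_0$; after $N_{1,j}<N$ observations with $\bar\Lambda_{N_{1,j}}>C_{1,j}$, for some $0\le j\le K_1$, rejecting $H_0$; after $N$ observations, rejecting $H_0$ if and only if $\bar\Lambda_N>C$. The free parameters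 are functions $\gamma_0,\gamma_1$ of $(\alpha,\beta)$, with values in the above ranges, selected as follows. Write $\gamma_{0,0}=\gamma_0$, $\gamma_{0,j}=(\beta/4)^j$, $\gamma_{1,0}=\gamma_1$, $\gamma_{1,j}=(\alpha/4)^j$ for $j\ge1$, and $$U_i(\gamma_i)=N_{i,0}+\sum_{j=1}^{K_i}N_{i,j}\,\gamma_{i,j-1}+N\,\gamma_{i,K_i}.$$ For each $i\in\{0,1\}$: $\gamma_i(\alpha,\beta)$ minimizes $U_i$ over its range, except possibly for pairs $(\alpha,\beta)$ in some set (which may be empty, or consist of all pairs), and, as $\alpha,\beta\to0$ within that set, $\gamma_i\to0$ and $|\log\gamma_0|/|\log\beta|\to0$ (if $i=0$), respectively $|\log\gamma_1|/|\log\alpha|\to0$ (if $i=1$). **Statement.** Suppose that $u_m\to\infty$ and $m-l_m\to\infty$ as $m\to\infty$. Then: 1. for all $m\ge1$ and $\alpha,\beta\in(0,1)$, $\mathcal E_m(\alpha,\beta)=\mathcal E(\alpha_m,\beta_m)$, and $\frac1m\sum_{j=1}^m\mathsf E_{\mathcal A}[T^j]=\mathsf E_{|\mathcal A|/m}[T]$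 for every test $(T,D)$ and every $\mathcal A\subseteq\{1,\dots,m\}$, so that $\mathcal L_{s/m}(\alpha_m,\beta_m)$ is the optimal expected average sample size under familywise error control at levels $\alpha,\beta$ when there are $s$ signals, $l_m\le s\le u_m$; 2. the family of SPRTs is asymptotically optimal in the high-dimensional sense; 3. for every selection of the free parameters as above, the family of GMTs is asymptotically optimal in the high-dimensional sense. -/

import Mathlib

open MeasureTheory Filter Topology InformationTheory
open scoped ENNReal

noncomputable section

/-- The binary testing problem: two densities `f 0`, `f 1` with respect to a σ-finite measure `ν`,
both of whose Kullback-Leibler divergences are positive and finite. -/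
structure BinaryProblem (𝒳 : Type*) [MeasurableSpace 𝒳] where
  ν : Measure 𝒳
  sigmaFinite : SigmaFinite ν
  f : Fin 2 → 𝒳 → ℝ
  measurable_f : ∀ i, Measurable (f i)
  f_nonneg : ∀ i x, 0 ≤ f i x
  lintegral_f : ∀ i, ∫⁻ x, ENNReal.ofReal (f i x) ∂ν = 1
  kl_zero_pos : 0 < klDiv (ν.withDensity fun x => ENNReal.ofReal (f 0 x))
    (ν.withDensity fun x => ENNReal.ofReal (f 1 x))
  kl_zero_lt_top : klDiv (ν.withDensity fun x => ENNReal.ofReal (f 0 x))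
    (ν.withDensity fun x => ENNReal.ofReal (f 1 x)) < ⊤
  kl_one_pos : 0 < klDiv (ν.withDensity fun x => ENNReal.ofReal (f 1 x))
    (ν.withDensity fun x => ENNReal.ofReal (f 0 x))
  kl_one_lt_top : klDiv (ν.withDensity fun x => ENNReal.ofReal (f 1 x))
    (ν.withDensity fun x => ENNReal.ofReal (f 0 x)) < ⊤

/-- A sample size together with a decision, as functions of one data stream `ω`, whose `n`-th
observation is `ω (n - 1)`. The decision `1` rejects the null hypothesis. -/
structure TestRule (𝒳 : Type*) where
  T : (ℕ → 𝒳) → ℕ∞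
  D : (ℕ → 𝒳) → Fin 2

/-- The σ-algebra generated by the first `n` observations. -/
@[reducible] def obsSigma (𝒳 : Type*) [MeasurableSpace 𝒳] (n : ℕ) : MeasurableSpace (ℕ → 𝒳) :=
  MeasurableSpace.comap (fun (ω : ℕ → 𝒳) (k : Fin n) => ω k) MeasurableSpace.pi

/-- The type-I level `1 - (1 - α) ^ (1 / (m - l))` per stream. -/
def levelI (m l : ℕ) (α : ℝ) : ℝ := 1 - (1 - α) ^ (1 / ((m : ℝ) - (l : ℝ)))

/-- The type-II level `1 - (1 - β) ^ (1 / u)` per stream. -/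
def levelII (u : ℕ) (β : ℝ) : ℝ := 1 - (1 - β) ^ (1 / (u : ℝ))

namespace BinaryProblem

variable {𝒳 : Type*} [MeasurableSpace 𝒳] (B : BinaryProblem 𝒳)

/-- The law of one observation under `H i`. -/
def law (i : Fin 2) : Measure 𝒳 := B.ν.withDensity fun x => ENNReal.ofReal (B.f i x)

instance instIsProbabilityMeasureLaw (i : Fin 2) : IsProbabilityMeasure (B.law i) :=
  ⟨by rw [law, withDensity_apply _ MeasurableSet.univ, Measure.restrict_univ, B.lintegral_f i]⟩

/-- The law `P i` of the whole sequence of independent observations under `H i`. -/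
def P (i : Fin 2) : Measure (ℕ → 𝒳) := Measure.infinitePi fun _ : ℕ => B.law i

instance instIsProbabilityMeasureP (i : Fin 2) : IsProbabilityMeasure (B.P i) := by
  unfold P; infer_instance

/-- The log-likelihood ratio of the first `n` observations. -/
def LLR (n : ℕ) (ω : ℕ → 𝒳) : ℝ :=
  ∑ k ∈ Finset.range n, Real.log (B.f 1 (ω k) / B.f 0 (ω k))

/-- The average log-likelihood ratio of the first `n` observations. -/
def avgLLR (n : ℕ) (ω : ℕ → 𝒳) : ℝ := B.LLR n ω / n

/-! ### Tests and optimal expected sample sizes -/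

/-- Sequential tests: `T` is a stopping time with values in `{1, 2, …}`, finite almost surely under
both hypotheses, and `D` is determined by the observations up to `T`. -/
structure IsTest (τ : TestRule 𝒳) : Prop where
  one_le : ∀ ω, 1 ≤ τ.T ω
  stopping : ∀ n : ℕ, MeasurableSet[obsSigma 𝒳 n] {ω | τ.T ω = n}
  decision : ∀ (n : ℕ) (i : Fin 2), MeasurableSet[obsSigma 𝒳 n] {ω | τ.T ω = n ∧ τ.D ω = i}
  measurable_D : Measurable τ.D
  finite : ∀ i, ∀ᵐ ω ∂(B.P i), τ.T ω < ⊤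

/-- The tests with type-I and type-II error probabilities at most `α` and `β`. -/
def testClass (α β : ℝ) : Set (TestRule 𝒳) :=
  {τ | B.IsTest τ ∧ B.P 0 {ω | τ.D ω = 1} ≤ ENNReal.ofReal α ∧
    B.P 1 {ω | τ.D ω = 0} ≤ ENNReal.ofReal β}

/-- The mixture `(1 - π) P 0 + π P 1`. -/
def mixture (π : ℝ) : Measure (ℕ → 𝒳) :=
  ENNReal.ofReal (1 - π) • B.P 0 + ENNReal.ofReal π • B.P 1

/-- The expected sample size under the mixture with weight `π`. -/
def ess (π : ℝ) (τ : TestRule 𝒳) : ℝ≥0∞ := ∫⁻ ω, (τ.T ω : ℝ≥0∞) ∂(B.mixture π)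

/-- The optimal expected sample size under the mixture with weight `π`, among all tests with
error probabilities at most `α` and `β`. -/
def optESS (π α β : ℝ) : ℝ≥0∞ := ⨅ τ ∈ B.testClass α β, B.ess π τ

/-! ### Multiple streams -/

/-- The joint law of `m` independent streams when `A` is the set of signals. -/
def streamLaw (m : ℕ) (A : Finset (Fin m)) : Measure (Fin m → ℕ → 𝒳) :=
  Measure.pi fun j => B.P (if j ∈ A then 1 else 0)

/-- Familywise type-I error probability. -/
def fweI {m : ℕ} (A : Finset (Fin m)) (τ : TestRule 𝒳) : ℝ≥0∞ :=
  B.streamLaw m A {x | ∃ j, j ∉ A ∧ τ.D (x j) = 1}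

/-- Familywise type-II error probability. -/
def fweII {m : ℕ} (A : Finset (Fin m)) (τ : TestRule 𝒳) : ℝ≥0∞ :=
  B.streamLaw m A {x | ∃ j, j ∈ A ∧ τ.D (x j) = 0}

/-- The tests which, applied to each of `m` streams, control both familywise error probabilities
for every set of signals of size between `l` and `u`. -/
def fweClass (m l u : ℕ) (α β : ℝ) : Set (TestRule 𝒳) :=
  {τ | B.IsTest τ ∧ ∀ A : Finset (Fin m), l ≤ A.card → A.card ≤ u →
    B.fweI A τ ≤ ENNReal.ofReal α ∧ B.fweII A τ ≤ ENNReal.ofReal β}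

/-- The expected average sample size over `m` streams when `A` is the set of signals. -/
def avgESS {m : ℕ} (A : Finset (Fin m)) (τ : TestRule 𝒳) : ℝ≥0∞ :=
  (m : ℝ≥0∞)⁻¹ * ∑ j, ∫⁻ x, (τ.T (x j) : ℝ≥0∞) ∂(B.streamLaw m A)

/-- Asymptotic optimality in the high-dimensional sense of a family of tests, where `l m` and `u m`
bound the number of signals among `m` streams. -/
def HighDimOptimal (l u : ℕ → ℕ) (χ : ℝ → ℝ → TestRule 𝒳) : Prop :=
  (∀ α ∈ Set.Ioo (0 : ℝ) 1, ∀ β ∈ Set.Ioo (0 : ℝ) 1, χ α β ∈ B.testClass α β) ∧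
  ∀ α ∈ Set.Ioo (0 : ℝ) 1, ∀ β ∈ Set.Ioo (0 : ℝ) 1,
    Tendsto (fun m : ℕ => (Finset.Icc (l m) (u m)).sup fun s : ℕ =>
      B.ess ((s : ℝ) / m) (χ (levelI m (l m) α) (levelII (u m) β)) /
        B.optESS ((s : ℝ) / m) (levelI m (l m) α) (levelII (u m) β)) atTop (𝓝 1)

/-! ### The Sequential Probability Ratio Test -/

/-- The first `n ≥ 1` at which the log-likelihood ratio leaves `(-b, a)`; infinite if there is
none. -/
def sprtTime (a b : ℝ) (ω : ℕ → 𝒳) : ℕ∞ :=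
  sInf {t : ℕ∞ | ∃ n : ℕ, t = n ∧ 1 ≤ n ∧ B.LLR n ω ∉ Set.Ioo (-b) a}

open Classical in
/-- The SPRT with thresholds `|log α|` and `|log β|`. -/
def sprt (α β : ℝ) : TestRule 𝒳 where
  T := B.sprtTime |Real.log α| |Real.log β|
  D := fun ω => if ∃ n : ℕ, B.sprtTime |Real.log α| |Real.log β| ω = n ∧ |Real.log α| ≤ B.LLR n ω
    then 1 else 0

/-! ### The fixed-sample-size test -/

/-- Rejecting exactly when the average log-likelihood ratio of `n` observations exceeds `c` has
error probabilities at most `α` and `β`. -/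
def FixedOK (α β : ℝ) (n : ℕ) (c : ℝ) : Prop :=
  B.P 0 {ω | c < B.avgLLR n ω} ≤ ENNReal.ofReal α ∧
    B.P 1 {ω | B.avgLLR n ω ≤ c} ≤ ENNReal.ofReal β

/-- The smallest sample size of a fixed-sample-size test with error probabilities at most
`α`, `β`. -/
def nStar (α β : ℝ) : ℕ := sInf {n : ℕ | 1 ≤ n ∧ ∃ c : ℝ, B.FixedOK α β n c}

/-- The smallest threshold that goes with the sample size `nStar α β`. -/
def cStar (α β : ℝ) : ℝ := sInf {c : ℝ | B.FixedOK α β (B.nStar α β) c}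

end BinaryProblem

/-! ### The General Multistage Test -/

/-- The parameters of a General Multistage Test. For `j ≤ K i`, `N i j` and `C i j` are the sample
size and the threshold at the opportunity number `j` to select `H i`; `Nlast`, `Clast` are those of
the last stage. -/
structure GMTParams where
  K : Fin 2 → ℕ
  N : Fin 2 → ℕ → ℕ
  C : Fin 2 → ℕ → ℝ
  Nlast : ℕ
  Clast : ℝ

/-- The error probability `γ` at the first opportunity (`j = 0`), and `(x / 4) ^ j` at the
later ones. -/
def inactiveErr (γ x : ℝ) (j : ℕ) : ℝ := if j = 0 then γ else (x / 4) ^ j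

/-- The error probability `3 x / 4 - ∑ j = 1, …, K, (x / 4) ^ j` at the first opportunity (`j = 0`),
and `(x / 4) ^ j` at the later ones. -/
def activeErr (x : ℝ) (K j : ℕ) : ℝ :=
  if j = 0 then 3 * x / 4 - ∑ k ∈ Finset.Icc 1 K, (x / 4) ^ k else (x / 4) ^ j

namespace BinaryProblem

variable {𝒳 : Type*} [MeasurableSpace 𝒳] (B : BinaryProblem 𝒳)

/-- The test stops and accepts after `n` observations. Only stages before the last one count: the
thresholds of opportunities with sample size `Nlast` are ignored. -/
def gmtAccepts (p : GMTParams) (n : ℕ) (ω : ℕ → 𝒳) : Prop :=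
  ∃ j ≤ p.K 0, p.N 0 j = n ∧ n < p.Nlast ∧ B.avgLLR n ω ≤ p.C 0 j

/-- The test stops and rejects after `n` observations, before the last stage. -/
def gmtRejects (p : GMTParams) (n : ℕ) (ω : ℕ → 𝒳) : Prop :=
  ∃ j ≤ p.K 1, p.N 1 j = n ∧ n < p.Nlast ∧ p.C 1 j < B.avgLLR n ω

/-- The sample size of the General Multistage Test. -/
def gmtTime (p : GMTParams) (ω : ℕ → 𝒳) : ℕ :=
  sInf {n : ℕ | B.gmtAccepts p n ω ∨ B.gmtRejects p n ω ∨ n = p.Nlast}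

open Classical in
/-- The General Multistage Test with parameters `p`. -/
def gmtOf (p : GMTParams) : TestRule 𝒳 where
  T := fun ω => (B.gmtTime p ω : ℕ∞)
  D := fun ω =>
    if B.gmtRejects p (B.gmtTime p ω) ω ∨
      (B.gmtTime p ω = p.Nlast ∧ p.Clast < B.avgLLR p.Nlast ω) then 1 else 0

/-- The number of additional opportunities to accept (`i = 0`) or to reject (`i = 1`). -/
def gmtK (α β : ℝ) (i : Fin 2) : ℕ :=
  if i = 0 then
    sSup {j : ℕ | B.nStar ((β / 4) ^ j) ((β / 4) ^ j) ≤ B.nStar (α / 4) (β / 4) ∧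
      3 * α / 4 ≤ (β / 4) ^ j}
  else
    sSup {j : ℕ | B.nStar ((α / 4) ^ j) ((α / 4) ^ j) ≤ B.nStar (α / 4) (β / 4) ∧
      3 * β / 4 ≤ (α / 4) ^ j}

/-- The type-I and type-II levels of the fixed-sample-size test at the opportunity number `j` to
select `H i`, when the free parameter is `γ`. -/
def gmtErr (α β : ℝ) (i : Fin 2) (γ : ℝ) (j : ℕ) : ℝ × ℝ :=
  if i = 0 then (inactiveErr γ β j, activeErr β (B.gmtK α β 0) j)
  else (activeErr α (B.gmtK α β 1) j, inactiveErr γ α j)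

/-- The parameters of the proposed design, with free parameters `γ 0` and `γ 1`. -/
def gmtParams (α β : ℝ) (γ : Fin 2 → ℝ) : GMTParams where
  K := B.gmtK α β
  N := fun i j => B.nStar (B.gmtErr α β i (γ i) j).1 (B.gmtErr α β i (γ i) j).2
  C := fun i j => B.cStar (B.gmtErr α β i (γ i) j).1 (B.gmtErr α β i (γ i) j).2
  Nlast := B.nStar (α / 4) (β / 4)
  Clast := B.cStar (α / 4) (β / 4)

/-- The family of General Multistage Tests, for a selection `γ` of the free parameters. -/
def gmt (γ : Fin 2 → ℝ → ℝ → ℝ) (α β : ℝ) : TestRule 𝒳 :=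
  B.gmtOf (B.gmtParams α β fun i => γ i α β)

/-- The upper bound on the expected sample size under `P i`, as a function of the free
parameter. -/
def gmtBound (α β : ℝ) (i : Fin 2) (γ : ℝ) : ℝ :=
  let n : ℕ → ℝ := fun j => (B.nStar (B.gmtErr α β i γ j).1 (B.gmtErr α β i γ j).2 : ℝ)
  let g : ℕ → ℝ := inactiveErr γ (if i = 0 then β else α)
  n 0 + ∑ j ∈ Finset.Icc 1 (B.gmtK α β i), n j * g (j - 1) +
    (B.nStar (α / 4) (β / 4) : ℝ) * g (B.gmtK α β i)

/-- The range of the free parameter: `(max (3 α) β / 4, 1)` for `i = 0` and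
`(max α (3 β) / 4, 1)` for `i = 1`. -/
def gmtRange (α β : ℝ) (i : Fin 2) : Set ℝ :=
  if i = 0 then Set.Ioo (max (3 * α) β / 4) 1 else Set.Ioo (max α (3 * β) / 4) 1

/-- The pairs `(α, β)` at which the selected parameter does not minimize the bound on the expected
sample size under `P i`. -/
def gmtNonMin (i : Fin 2) (γ : ℝ → ℝ → ℝ) : Set (ℝ × ℝ) :=
  {q | ¬ IsMinOn (B.gmtBound q.1 q.2 i) (gmtRange q.1 q.2 i) (γ q.1 q.2)}

/-- Admissible selections of the free parameter for `i`: at each `(α, β)` the parameter lies in its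
range, and it minimizes the bound, except possibly at a set of pairs `(α, β)` along which, as
`α, β → 0`, it vanishes while its logarithm is negligible relative to `|log β|` (for `i = 0`) or
`|log α|` (for `i = 1`). The set of exceptional pairs may be empty (minimizers everywhere), and it
may consist of all pairs. -/
def GMTSelection (i : Fin 2) (γ : ℝ → ℝ → ℝ) : Prop :=
  (∀ α ∈ Set.Ioo (0 : ℝ) 1, ∀ β ∈ Set.Ioo (0 : ℝ) 1, γ α β ∈ gmtRange α β i) ∧
  Tendsto (fun q : ℝ × ℝ => γ q.1 q.2)
    ((𝓝[>] (0 : ℝ) ×ˢ 𝓝[>] (0 : ℝ)) ⊓ 𝓟 (B.gmtNonMin i γ)) (𝓝 0) ∧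
  Tendsto (fun q : ℝ × ℝ => |Real.log (γ q.1 q.2)| / |Real.log (if i = 0 then q.2 else q.1)|)
    ((𝓝[>] (0 : ℝ) ×ˢ 𝓝[>] (0 : ℝ)) ⊓ 𝓟 (B.gmtNonMin i γ)) (𝓝 0)

end BinaryProblem

end

/-!
A change of measure shows that, under `P 0`, a test with small error probabilities cannot stop
before `Λ` has fallen to about `log β`; as `Λ` drifts down at rate `I₀`, every test satisfies
`E₀[T] ≥ (1 - o(1)) |log β| / I₀` as `α, β → 0`, and `E₁[T] ≥ (1 - o(1)) |log α| / I₁` follows by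
exchanging the hypotheses. A family of tests that attains both bounds to first order minimizes
`E_π[T]` to first order uniformly in the prevalence `π`, which is what is needed for the maximum
over the number of signals, because `α_m` and `β_m` vanish.

The SPRT attains the bounds since the first exit time of a random walk with drift `c` over a level
`b` has expectation at most `(1 + o(1)) b / c`. For the multistage test, Chernoff's bound and the
law of large numbers give Stein's lemma in the form `n*(a, b) ≤ max (|log b| / I, |log a| / r) + 1`,
for every `I < I₀` and some `r > 0`. Hence its first opportunity to accept needs about
`|log β| / I₀` observations when `|log γ₀|` is negligible, and the later stages contribute little
because they are reached with geometrically decreasing probabilities. The minimizing free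
parameter does at least as well as one that vanishes slowly.
-/

noncomputable section

/-! ### Measure-theoretic preliminaries -/

lemma pi_withDensity {ι : Type*} [Fintype ι] {Ω : ι → Type*} [∀ i, MeasurableSpace (Ω i)]
    (μ : ∀ i, Measure (Ω i)) [∀ i, IsProbabilityMeasure (μ i)] {g : ∀ i, Ω i → ℝ≥0∞}
    (hg : ∀ i, Measurable (g i)) [∀ i, SigmaFinite ((μ i).withDensity (g i))] :
    Measure.pi (fun i => (μ i).withDensity (g i)) =
      (Measure.pi μ).withDensity fun x => ∏ i, g i (x i) := by
  refine Measure.pi_eq fun s hs => ?_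
  have hgs (i : ι) : Measurable ((s i).indicator (g i)) := (hg i).indicator (hs i)
  have hprod : (Set.univ.pi s).indicator (fun x => ∏ i, g i (x i)) =
      fun x => ∏ i, (s i).indicator (g i) (x i) := by
    classical
    ext x
    simp only [Set.indicator_apply, Finset.prod_ite_zero, Set.mem_univ_pi, Finset.mem_univ,
      true_implies]
  rw [withDensity_apply _ (.univ_pi hs), ← lintegral_indicator (.univ_pi hs), hprod,
    ProbabilityTheory.lintegral_prod_eq_prod_lintegral_of_indepFun _ _
      (ProbabilityTheory.iIndepFun_pi fun i => (hgs i).aemeasurable)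
      fun i => (hgs i).comp (measurable_pi_apply i)]
  refine Finset.prod_congr rfl fun i _ => ?_
  rw [withDensity_apply _ (hs i), ← lintegral_indicator (hs i)]
  exact (measurePreserving_eval μ i).lintegral_comp (hgs i)

lemma toENNReal_eq_tsum (t : ℕ∞) :
    (t : ℝ≥0∞) = ∑' k : ℕ, if (k : ℕ∞) < t then (1 : ℝ≥0∞) else 0 := by
  induction t using ENat.recTopCoe with
  | top => simp
  | coe n =>
    rw [tsum_eq_sum (s := Finset.range n) fun k hk => if_neg (by simpa using hk),
      Finset.sum_congr rfl fun k hk => if_pos (Nat.cast_lt.2 (Finset.mem_range.1 hk))]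
    simp

lemma lintegral_toENNReal_eq_tsum {Ω : Type*} [MeasurableSpace Ω] {T : Ω → ℕ∞} (hT : Measurable T)
    (μ : Measure Ω) : ∫⁻ ω, (T ω : ℝ≥0∞) ∂μ = ∑' k : ℕ, μ {ω | (k : ℕ∞) < T ω} := by
  have hlt (k : ℕ) : MeasurableSet {ω | (k : ℕ∞) < T ω} :=
    hT (.of_discrete (s := Set.Ioi (k : ℕ∞)))
  simp_rw [toENNReal_eq_tsum]
  rw [lintegral_tsum fun k =>
    (Measurable.ite (hlt k) measurable_const measurable_const).aemeasurable]
  refine tsum_congr fun k => ?_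
  rw [← lintegral_indicator_one (hlt k)]
  simp only [Set.indicator_apply, Set.mem_ofPred_eq, Pi.one_apply]

section ProbabilityMeasure

variable {Ω : Type*} [MeasurableSpace Ω] {μ : Measure Ω} [IsProbabilityMeasure μ] {X : Ω → ℝ}
  {c : ℝ}

lemma exists_lt_integral_min (hX : Integrable X μ) (hc : c < ∫ x, X x ∂μ) :
    ∃ M, c < ∫ x, min (X x) M ∂μ := by
  have hlim : Tendsto (fun n : ℕ => ∫ x, min (X x) n ∂μ) atTop (𝓝 (∫ x, X x ∂μ)) := by
    refine tendsto_integral_of_dominated_convergence (fun x => |X x|)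
      (fun n => (hX.inf (integrable_const (n : ℝ))).aestronglyMeasurable) hX.abs
      (fun n => .of_forall fun x => abs_le.2 ⟨?_, ?_⟩) (.of_forall fun x => ?_)
    · exact le_min (neg_abs_le _) ((neg_nonpos.2 (abs_nonneg _)).trans n.cast_nonneg)
    · exact (min_le_left _ _).trans (le_abs_self _)
    · obtain ⟨n, hn⟩ := exists_nat_ge (X x)
      refine tendsto_const_nhds.congr' ?_
      filter_upwards [eventually_ge_atTop n] with m hm
      rw [min_eq_left (hn.trans (Nat.cast_le.2 hm))]
  obtain ⟨n, hn⟩ := (hlim.eventually (lt_mem_nhds hc)).exists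
  exact ⟨n, hn⟩

lemma abs_slope_exp_le {θ y : ℝ} (hθ : θ ∈ Set.Ioc (0 : ℝ) 1) :
    |(Real.exp (θ * y) - 1) / θ| ≤ |y| + Real.exp y + 1 := by
  have hlow : y ≤ (Real.exp (θ * y) - 1) / θ := by
    rw [le_div_iff₀ hθ.1]
    linarith [Real.add_one_le_exp (θ * y)]
  have hup : (Real.exp (θ * y) - 1) / θ ≤ Real.exp y - 1 := by
    have hconv := convexOn_exp.2 (Set.mem_univ y) (Set.mem_univ 0) hθ.1.le (sub_nonneg.2 hθ.2)
      (by ring)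
    simp only [smul_eq_mul, mul_zero, add_zero, Real.exp_zero, mul_one] at hconv
    rw [div_le_iff₀ hθ.1]
    linarith
  rw [abs_le]
  constructor <;> linarith [neg_abs_le y, abs_nonneg y, Real.exp_pos y]

lemma tendsto_integral_slope_exp (hX : Integrable X μ)
    (hexp : Integrable (fun x => Real.exp (X x)) μ) :
    Tendsto (fun θ : ℝ => ∫ x, (Real.exp (θ * X x) - 1) / θ ∂μ) (𝓝[>] 0) (𝓝 (∫ x, X x ∂μ)) := by
  have hmeas (θ : ℝ) : AEStronglyMeasurable (fun x => (Real.exp (θ * X x) - 1) / θ) μ :=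
    ((Real.measurable_exp.comp_aemeasurable (hX.aemeasurable.const_mul θ)).sub_const 1
      |>.div_const θ).aestronglyMeasurable
  refine tendsto_integral_filter_of_dominated_convergence (fun x => |X x| + Real.exp (X x) + 1)
    (.of_forall hmeas) ?_ ((hX.abs.add hexp).add (integrable_const 1)) (.of_forall fun x => ?_)
  · filter_upwards [Ioc_mem_nhdsGT (zero_lt_one' ℝ)] with θ hθ
    exact .of_forall fun x => abs_slope_exp_le hθ
  · have hderiv : HasDerivAt (fun θ : ℝ => Real.exp (θ * X x)) (X x) 0 := by
      simpa using ((hasDerivAt_id (0 : ℝ)).mul_const (X x)).exp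
    refine ((hasDerivAt_iff_tendsto_slope_zero.1 hderiv).mono_left
      (nhdsWithin_mono (0 : ℝ) fun y (hy : 0 < y) => ne_of_gt hy)).congr fun θ => ?_
    simp [div_eq_inv_mul]

lemma exists_cgf_lt_mul (hX : Integrable X μ) (hexp : Integrable (fun x => Real.exp (X x)) μ)
    (hc : ∫ x, X x ∂μ < c) :
    ∃ θ ∈ Set.Ioc (0 : ℝ) 1, ProbabilityTheory.cgf X μ θ < θ * c := by
  obtain ⟨θ, hslope, hθ⟩ := (((tendsto_integral_slope_exp hX hexp).eventually
    (gt_mem_nhds hc)).and (Ioc_mem_nhdsGT (zero_lt_one' ℝ))).exists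
  have hint : Integrable (fun x => Real.exp (θ * X x)) μ :=
    ProbabilityTheory.integrable_exp_mul_of_nonneg_of_le (u := 1) (by simpa using hexp)
      hθ.1.le hθ.2
  refine ⟨θ, hθ, ?_⟩
  rw [integral_div, integral_sub hint (integrable_const 1), div_lt_iff₀ hθ.1] at hslope
  simp only [integral_const, probReal_univ, smul_eq_mul, mul_one] at hslope
  have hlog := Real.log_le_sub_one_of_pos (ProbabilityTheory.mgf_pos hint)
  rw [ProbabilityTheory.cgf]
  rw [ProbabilityTheory.mgf] at hlog ⊢
  linarith

end ProbabilityMeasure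

/-! ### Sequences of independent observations -/

section Observations

variable {𝒳 : Type*} [MeasurableSpace 𝒳]

lemma measurable_firstObs (n : ℕ) : Measurable fun (ω : ℕ → 𝒳) (k : Fin n) => ω k :=
  measurable_pi_lambda _ fun _ => measurable_pi_apply _

lemma obsSigma_le (n : ℕ) : obsSigma 𝒳 n ≤ MeasurableSpace.pi :=
  (measurable_firstObs n).comap_le

lemma measurable_obsSigma_eval {k n : ℕ} (hk : k < n) :
    Measurable[obsSigma 𝒳 n] fun ω : ℕ → 𝒳 => ω k :=
  (measurable_pi_apply (⟨k, hk⟩ : Fin n)).comp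
    (comap_measurable fun (ω : ℕ → 𝒳) (i : Fin n) => ω i)

lemma obsSigma_mono : Monotone (obsSigma 𝒳) := fun _ _ h =>
  (@measurable_pi_lambda _ _ _ (obsSigma 𝒳 _) _ _ fun k =>
    measurable_obsSigma_eval (k.2.trans_le h)).comap_le

/-- The filtration generated by the observations: at time `n` the first `n` of them are known. -/
def obsFiltration (𝒳 : Type*) [MeasurableSpace 𝒳] :
    Filtration ℕ (MeasurableSpace.pi : MeasurableSpace (ℕ → 𝒳)) where
  seq := obsSigma 𝒳
  mono' := obsSigma_mono
  le' := obsSigma_le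

lemma measurable_obsSigma_sum {Y : 𝒳 → ℝ} (hY : Measurable Y) {m n : ℕ} (h : m ≤ n) :
    Measurable[obsSigma 𝒳 n] fun ω : ℕ → 𝒳 => ∑ k ∈ Finset.range m, Y (ω k) :=
  Finset.measurable_fun_sum _ fun _ hk =>
    hY.comp (measurable_obsSigma_eval ((Finset.mem_range.1 hk).trans_le h))

/-- The law of a sequence of independent observations, each with law `μ`. -/
abbrev iidLaw (μ : Measure 𝒳) : Measure (ℕ → 𝒳) := Measure.infinitePi fun _ => μ

variable {μ : Measure 𝒳} [IsProbabilityMeasure μ] {Y : 𝒳 → ℝ} {c : ℝ}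

lemma iIndepFun_eval_iidLaw : ProbabilityTheory.iIndepFun (fun k (ω : ℕ → 𝒳) => ω k) (iidLaw μ) :=
  ProbabilityTheory.iIndepFun_infinitePi (X := fun _ x => x) fun _ => measurable_id

lemma map_firstObs_iidLaw (n : ℕ) :
    (iidLaw μ).map (fun ω (k : Fin n) => ω k) = Measure.pi fun _ => μ := by
  rw [iidLaw, Measure.map_infinitePi_infinitePi_of_inj Fin.val_injective, Measure.infinitePi_eq_pi]

lemma indep_obsSigma_eval (n : ℕ) :
    ProbabilityTheory.Indep (obsSigma 𝒳 n)
      (MeasurableSpace.comap (fun ω : ℕ → 𝒳 => ω n) inferInstance) (iidLaw μ) := by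
  have h := (iIndepFun_eval_iidLaw (μ := μ)).indepFun_finset (Finset.range n) {n} (by simp)
    fun k => measurable_pi_apply k
  have hfirst : Measurable fun (x : Finset.range n → 𝒳) (k : Fin n) =>
      x ⟨k, Finset.mem_range.2 k.2⟩ := measurable_pi_lambda _ fun _ => measurable_pi_apply _
  exact h.comp hfirst (measurable_pi_apply ⟨n, Finset.mem_singleton_self n⟩)

lemma integral_eval_iidLaw (hY : Measurable Y) (k : ℕ) :
    ∫ ω, Y (ω k) ∂(iidLaw μ) = ∫ x, Y x ∂μ := by
  have hmp := measurePreserving_eval_infinitePi (fun _ : ℕ => μ) k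
  calc ∫ ω, Y (ω k) ∂(iidLaw μ) = ∫ x, Y x ∂((iidLaw μ).map (Function.eval k)) :=
        (integral_map hmp.measurable.aemeasurable hY.aestronglyMeasurable).symm
    _ = ∫ x, Y x ∂μ := by rw [hmp.map_eq]

lemma integrable_eval_iidLaw (hY : Integrable Y μ) (k : ℕ) :
    Integrable (fun ω => Y (ω k)) (iidLaw μ) :=
  (measurePreserving_eval_infinitePi (fun _ => μ) k).integrable_comp_of_integrable hY

lemma identDistrib_eval_iidLaw (hY : Measurable Y) (k : ℕ) :
    ProbabilityTheory.IdentDistrib (fun ω => Y (ω k)) Y (iidLaw μ) μ where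
  aemeasurable_fst := (hY.comp (measurable_pi_apply k)).aemeasurable
  aemeasurable_snd := hY.aemeasurable
  map_eq := by
    rw [← Measure.infinitePi_map_eval (fun _ : ℕ => μ) k,
      Measure.map_map hY (measurable_pi_apply k)]
    simp only [Measure.infinitePi_map_eval]
    rfl

lemma iIndepFun_comp_eval_iidLaw (hY : Measurable Y) :
    ProbabilityTheory.iIndepFun (fun k ω => Y (ω k)) (iidLaw μ) :=
  iIndepFun_eval_iidLaw.comp (fun _ => Y) fun _ => hY

/-! ### Expected exit times -/

lemma sum_stopped_le {y : ℕ → ℝ} {t : ℕ∞} {b M : ℝ} (hbM : 0 ≤ b + M) (hy : ∀ k, y k ≤ M)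
    (hb : ∀ n : ℕ, (n : ℕ∞) < t → ∑ k ∈ Finset.range n, y k ≤ b) (n : ℕ) :
    ∑ k ∈ Finset.range n, (if (k : ℕ∞) < t then y k else 0) ≤ b + M := by
  induction n with
  | zero => simpa using hbM
  | succ n ih =>
    rw [Finset.sum_range_succ]
    split_ifs with hn
    · refine add_le_add (le_trans (Finset.sum_le_sum fun k hk => ?_) (hb n hn)) (hy n)
      rw [if_pos ((Nat.cast_lt.2 (Finset.mem_range.1 hk)).trans hn)]
    · rwa [add_zero]

lemma lintegral_stoppingTime_le (hY : Measurable Y) (hint : Integrable Y μ) {M : ℝ}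
    (hYM : ∀ x, Y x ≤ M) (hpos : 0 < ∫ x, Y x ∂μ) {T : (ℕ → 𝒳) → ℕ∞}
    (hT : IsStoppingTime (obsFiltration 𝒳) T) {b : ℝ} (hb : 0 ≤ b)
    (hTb : ∀ ω, ∀ n : ℕ, (n : ℕ∞) < T ω → ∑ k ∈ Finset.range n, Y (ω k) ≤ b) :
    ∫⁻ ω, (T ω : ℝ≥0∞) ∂(iidLaw μ) ≤ ENNReal.ofReal ((b + M) / ∫ x, Y x ∂μ) := by
  have hM : ∫ x, Y x ∂μ ≤ M := by
    simpa using integral_mono hint (integrable_const M) hYM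
  have hlt (k : ℕ) : MeasurableSet[obsSigma 𝒳 k] {ω | (k : ℕ∞) < T ω} := hT.measurableSet_gt k
  have hlt' (k : ℕ) : MeasurableSet {ω | (k : ℕ∞) < T ω} := obsSigma_le k _ (hlt k)
  have hmeas : Measurable T :=
    ENat.measurable_iff.2 fun n => obsSigma_le n _ (hT.measurableSet_eq n)
  have hsummand (k : ℕ) : ∫ ω, {ω | (k : ℕ∞) < T ω}.indicator (fun ω => Y (ω k)) ω ∂(iidLaw μ) =
      (iidLaw μ).real {ω | (k : ℕ∞) < T ω} * ∫ x, Y x ∂μ := by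
    rw [integral_indicator (hlt' k), (indep_obsSigma_eval k).setIntegral_eq_mul (obsSigma_le k)
      (measurable_pi_apply k).aemeasurable (hlt k) hY.aestronglyMeasurable,
      integral_eval_iidLaw hY]
  rw [lintegral_toENNReal_eq_tsum hmeas]
  refine ENNReal.tsum_le_of_sum_range_le fun n => ?_
  have hints (k : ℕ) : Integrable ({ω | (k : ℕ∞) < T ω}.indicator fun ω => Y (ω k)) (iidLaw μ) :=
    (integrable_eval_iidLaw hint k).indicator (hlt' k)
  have hsum : (∑ k ∈ Finset.range n, (iidLaw μ).real {ω | (k : ℕ∞) < T ω}) * ∫ x, Y x ∂μ ≤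
      b + M := by
    rw [Finset.sum_mul, ← Finset.sum_congr rfl fun k _ => hsummand k,
      ← integral_finsetSum _ fun k _ => hints k]
    refine (integral_mono (integrable_finsetSum _ fun k _ => hints k)
      (integrable_const (b + M)) fun ω => ?_).trans_eq (by simp)
    simpa only [Set.indicator_apply, Set.mem_ofPred_eq] using
      sum_stopped_le (by linarith) (fun k => hYM (ω k)) (hTb ω) n
  rw [← le_div_iff₀ hpos] at hsum
  refine le_of_eq_of_le ?_ (ENNReal.ofReal_le_ofReal hsum)
  rw [ENNReal.ofReal_sum_of_nonneg fun k _ => measureReal_nonneg]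
  exact Finset.sum_congr rfl fun k _ => (ofReal_measureReal).symm

-- Truncating the increments from above keeps the drift above `c` and bounds the overshoot.
lemma exists_lintegral_stoppingTime_le (hY : Measurable Y) (hint : Integrable Y μ) (hc : 0 < c)
    (hcY : c < ∫ x, Y x ∂μ) :
    ∃ C, ∀ T : (ℕ → 𝒳) → ℕ∞, IsStoppingTime (obsFiltration 𝒳) T → ∀ b : ℝ, 0 ≤ b →
      (∀ ω, ∀ n : ℕ, (n : ℕ∞) < T ω → ∑ k ∈ Finset.range n, Y (ω k) ≤ b) →
      ∫⁻ ω, (T ω : ℝ≥0∞) ∂(iidLaw μ) ≤ ENNReal.ofReal ((b + C) / c) := by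
  obtain ⟨M, hM⟩ := exists_lt_integral_min hint hcY
  refine ⟨max M 0, fun T hT b hb hTb => ?_⟩
  refine (lintegral_stoppingTime_le (hY.min measurable_const) (hint.inf (integrable_const M))
    (fun x => min_le_right (Y x) M) (hc.trans hM) hT hb fun ω n hn => ?_).trans ?_
  · exact (Finset.sum_le_sum fun k _ => min_le_left _ _).trans (hTb ω n hn)
  · refine ENNReal.ofReal_le_ofReal ?_
    have : 0 ≤ max M 0 := le_max_right _ _
    exact div_le_div₀ (by positivity) (by linarith [le_max_left M 0]) hc hM.le

/-! ### The law of large numbers and Chernoff's bound -/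

lemma tendsto_average_iidLaw (hY : Measurable Y) (hint : Integrable Y μ) :
    ∀ᵐ ω ∂(iidLaw μ), Tendsto (fun n : ℕ => (∑ k ∈ Finset.range n, Y (ω k)) / n) atTop
      (𝓝 (∫ x, Y x ∂μ)) := by
  have h := ProbabilityTheory.strong_law_ae_real (μ := iidLaw μ) (fun k ω => Y (ω k))
    (integrable_eval_iidLaw hint 0)
    (fun _ _ hij => (iIndepFun_comp_eval_iidLaw hY).indepFun hij)
    fun k => (identDistrib_eval_iidLaw hY k).trans (identDistrib_eval_iidLaw hY 0).symm
  rwa [integral_eval_iidLaw hY] at h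

lemma eventually_forall_le_mul_of_tendsto_div {s : ℕ → ℝ} {x : ℝ}
    (hs : Tendsto (fun n : ℕ => s n / n) atTop (𝓝 x)) (hxc : x < c) (hc : 0 < c) :
    ∀ᶠ n : ℕ in atTop, ∀ k ≤ n, s k ≤ c * n := by
  obtain ⟨k₀, hk₀⟩ := eventually_atTop.1 (hs.eventually (gt_mem_nhds hxc))
  obtain ⟨N, hN⟩ := exists_nat_ge ((∑ j ∈ Finset.range (k₀ + 1), |s j|) / c)
  rw [div_le_iff₀' hc] at hN
  filter_upwards [eventually_ge_atTop N] with n hn k hk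
  rcases lt_or_ge k (k₀ + 1) with h | h
  · calc s k ≤ |s k| := le_abs_self _
      _ ≤ ∑ j ∈ Finset.range (k₀ + 1), |s j| :=
          Finset.single_le_sum (fun j _ => abs_nonneg (s j)) (Finset.mem_range.2 h)
      _ ≤ c * n := hN.trans (by gcongr)
  · have hk0 : (0 : ℝ) < k := Nat.cast_pos.2 (by omega)
    have hlt := hk₀ k (by omega)
    rw [div_lt_iff₀ hk0] at hlt
    exact hlt.le.trans (by gcongr)

lemma tendsto_measure_exists_sum_gt (hY : Measurable Y) (hint : Integrable Y μ) (hc : 0 < c)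
    (hYc : ∫ x, Y x ∂μ < c) :
    Tendsto (fun n : ℕ => iidLaw μ {ω | ∃ k ≤ n, c * n < ∑ j ∈ Finset.range k, Y (ω j)}) atTop
      (𝓝 0) := by
  rw [← measure_empty (μ := iidLaw μ)]
  refine tendsto_measure_of_ae_tendsto_indicator_of_isFiniteMeasure atTop .empty (fun n => ?_) ?_
  · have hunion : {ω : ℕ → 𝒳 | ∃ k ≤ n, c * n < ∑ j ∈ Finset.range k, Y (ω j)} =
        ⋃ k ∈ Set.Iic n, {ω | c * n < ∑ j ∈ Finset.range k, Y (ω j)} := by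
      ext ω; simp
    rw [hunion]
    exact .biUnion (Set.to_countable _) fun k _ => measurableSet_lt measurable_const
      ((measurable_obsSigma_sum hY le_rfl).mono (obsSigma_le k) le_rfl)
  · filter_upwards [tendsto_average_iidLaw hY hint] with ω hω
    filter_upwards [eventually_forall_le_mul_of_tendsto_div hω hYc hc] with n hn
    simpa using hn

lemma exists_measure_sum_ge_le_exp (hY : Measurable Y) (hint : Integrable Y μ)
    (hexp : Integrable (fun x => Real.exp (Y x)) μ) (hYc : ∫ x, Y x ∂μ < c) :
    ∃ r, 0 < r ∧ ∀ n : ℕ, iidLaw μ {ω | n * c ≤ ∑ k ∈ Finset.range n, Y (ω k)} ≤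
      ENNReal.ofReal (Real.exp (-(n * r))) := by
  obtain ⟨θ, hθ, hcgf⟩ := exists_cgf_lt_mul hint hexp hYc
  refine ⟨θ * c - ProbabilityTheory.cgf Y μ θ, sub_pos.2 hcgf, fun n => ?_⟩
  have hmeas (k : ℕ) : Measurable fun ω : ℕ → 𝒳 => Y (ω k) := hY.comp (measurable_pi_apply k)
  have hindep := iIndepFun_comp_eval_iidLaw (μ := μ) hY
  have hintθ (k : ℕ) : Integrable (fun ω => Real.exp (θ * Y (ω k))) (iidLaw μ) :=
    integrable_eval_iidLaw (ProbabilityTheory.integrable_exp_mul_of_nonneg_of_le (u := 1)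
      (by simpa using hexp) hθ.1.le hθ.2) k
  have hcgf_eval (k : ℕ) : ProbabilityTheory.cgf (fun ω => Y (ω k)) (iidLaw μ) θ =
      ProbabilityTheory.cgf Y μ θ := by
    rw [ProbabilityTheory.cgf, ProbabilityTheory.cgf,
      ProbabilityTheory.mgf_congr_identDistrib (identDistrib_eval_iidLaw hY k)]
  have hchernoff := ProbabilityTheory.measure_ge_le_exp_cgf (n * c) hθ.1.le
    (hindep.integrable_exp_mul_sum hmeas (s := Finset.range n) fun k _ => hintθ k)
  rw [hindep.cgf_sum hmeas fun k _ => hintθ k, Finset.sum_congr rfl fun k _ => hcgf_eval k,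
    Finset.sum_const, Finset.card_range, nsmul_eq_mul] at hchernoff
  simp only [Finset.sum_apply] at hchernoff
  rw [← ofReal_measureReal]
  refine ENNReal.ofReal_le_ofReal (hchernoff.trans_eq ?_)
  congr 1
  ring

end Observations

/-! ### The log-likelihood ratio -/

namespace BinaryProblem

variable {𝒳 : Type*} [MeasurableSpace 𝒳] (B : BinaryProblem 𝒳)

/-- The testing problem with the two hypotheses exchanged, which reduces every statement about
`H 1` to one about `H 0`. -/
def swap : BinaryProblem 𝒳 where
  ν := B.ν
  sigmaFinite := B.sigmaFinite
  f := ![B.f 1, B.f 0]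
  measurable_f := Fin.forall_fin_two.2 ⟨B.measurable_f 1, B.measurable_f 0⟩
  f_nonneg := Fin.forall_fin_two.2 ⟨B.f_nonneg 1, B.f_nonneg 0⟩
  lintegral_f := Fin.forall_fin_two.2 ⟨B.lintegral_f 1, B.lintegral_f 0⟩
  kl_zero_pos := by simpa using B.kl_one_pos
  kl_zero_lt_top := by simpa using B.kl_one_lt_top
  kl_one_pos := by simpa using B.kl_zero_pos
  kl_one_lt_top := by simpa using B.kl_zero_lt_top

/-- The log-likelihood ratio of one observation. -/
def logLR (x : 𝒳) : ℝ := Real.log (B.f 1 x / B.f 0 x)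

/-- The Kullback-Leibler divergence `I₀` of `f 0` from `f 1`. The divergence `I₁` of `f 1` from
`f 0` is `B.swap.info`. -/
def info : ℝ := ∫ x, -B.logLR x ∂(B.law 0)

lemma P_eq_iidLaw (i : Fin 2) : B.P i = iidLaw (B.law i) := rfl

lemma LLR_eq_sum (n : ℕ) (ω : ℕ → 𝒳) : B.LLR n ω = ∑ k ∈ Finset.range n, B.logLR (ω k) := rfl

lemma swap_P_zero : B.swap.P 0 = B.P 1 := rfl

lemma swap_P_one : B.swap.P 1 = B.P 0 := rfl

lemma swap_logLR (x : 𝒳) : B.swap.logLR x = -B.logLR x := by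
  change Real.log (B.f 0 x / B.f 1 x) = -Real.log (B.f 1 x / B.f 0 x)
  rw [← Real.log_inv, inv_div]

lemma swap_LLR (n : ℕ) (ω : ℕ → 𝒳) : B.swap.LLR n ω = -B.LLR n ω := by
  simp [LLR_eq_sum, swap_logLR]

lemma swap_avgLLR (n : ℕ) (ω : ℕ → 𝒳) : B.swap.avgLLR n ω = -B.avgLLR n ω := by
  simp [avgLLR, swap_LLR, neg_div]

lemma measurable_logLR : Measurable B.logLR :=
  Real.measurable_log.comp ((B.measurable_f 1).div (B.measurable_f 0))

lemma measurable_obsSigma_LLR {m n : ℕ} (h : m ≤ n) : Measurable[obsSigma 𝒳 n] (B.LLR m) :=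
  measurable_obsSigma_sum B.measurable_logLR h

lemma measurable_obsSigma_avgLLR {m n : ℕ} (h : m ≤ n) : Measurable[obsSigma 𝒳 n] (B.avgLLR m) :=
  (B.measurable_obsSigma_LLR h).div_const _

lemma measurable_LLR (n : ℕ) : Measurable (B.LLR n) :=
  (B.measurable_obsSigma_LLR le_rfl).mono (obsSigma_le n) le_rfl

lemma measurable_avgLLR (n : ℕ) : Measurable (B.avgLLR n) := (B.measurable_LLR n).div_const _

lemma law_zero_absolutelyContinuous : B.law 0 ≪ B.law 1 :=
  (klDiv_ne_top_iff.1 B.kl_zero_lt_top.ne).1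

lemma ae_pos_one_of_pos_zero : ∀ᵐ x ∂B.ν, 0 < B.f 0 x → 0 < B.f 1 x := by
  have hpos : ∀ᵐ x ∂(B.law 1), 0 < B.f 1 x := by
    rw [law, ae_withDensity_iff (B.measurable_f 1).ennreal_ofReal]
    exact .of_forall fun x hx => by simpa using hx
  have hpos' : ∀ᵐ x ∂(B.law 0), 0 < B.f 1 x := B.law_zero_absolutelyContinuous.ae_le hpos
  rw [law, ae_withDensity_iff (B.measurable_f 0).ennreal_ofReal] at hpos'
  filter_upwards [hpos'] with x hx h0
  exact hx (by simpa using h0)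

lemma law_zero_withDensity_exp_logLR :
    (B.law 0).withDensity (fun x => ENNReal.ofReal (Real.exp (B.logLR x))) = B.law 1 := by
  rw [law, ← withDensity_mul _ (B.measurable_f 0).ennreal_ofReal
    B.measurable_logLR.exp.ennreal_ofReal, law]
  refine withDensity_congr_ae ?_
  filter_upwards [B.ae_pos_one_of_pos_zero, B.swap.ae_pos_one_of_pos_zero] with x h01 h10
  rw [Pi.mul_apply, ← ENNReal.ofReal_mul (B.f_nonneg 0 x)]
  rcases (B.f_nonneg 0 x).eq_or_lt with h0 | h0
  · have h1 : B.f 1 x = 0 := le_antisymm (not_lt.1 fun h => (h10 h).ne h0) (B.f_nonneg 1 x)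
    rw [← h0, h1, zero_mul]
  · rw [logLR, Real.exp_log (div_pos (h01 h0) h0), mul_div_cancel₀ _ h0.ne']

lemma llr_law_one_law_zero : llr (B.law 1) (B.law 0) =ᵐ[B.law 0] B.logLR := by
  have h := Measure.rnDeriv_withDensity (B.law 0) B.measurable_logLR.exp.ennreal_ofReal
  rw [B.law_zero_withDensity_exp_logLR] at h
  filter_upwards [h] with x hx
  rw [llr, hx, ENNReal.toReal_ofReal (Real.exp_pos _).le, Real.log_exp]

lemma llr_law_zero_law_one : llr (B.law 0) (B.law 1) =ᵐ[B.law 0] fun x => -B.logLR x := by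
  filter_upwards [B.law_zero_absolutelyContinuous.ae_le B.swap.llr_law_one_law_zero] with x hx
  rw [← B.swap_logLR]
  exact hx

lemma integrable_logLR : Integrable B.logLR (B.law 0) := by
  have h := (klDiv_ne_top_iff.1 B.kl_zero_lt_top.ne).2.congr B.llr_law_zero_law_one
  exact integrable_neg_iff.1 h

lemma integral_logLR : ∫ x, B.logLR x ∂(B.law 0) = -B.info := by
  rw [info, integral_neg, neg_neg]

lemma info_pos : 0 < B.info := by
  have hkl : (klDiv (B.law 0) (B.law 1)).toReal = B.info := by
    rw [toReal_klDiv_of_measure_eq B.law_zero_absolutelyContinuous (by simp), info]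
    exact integral_congr_ae B.llr_law_zero_law_one
  rw [← hkl]
  exact ENNReal.toReal_pos B.kl_zero_pos.ne' B.kl_zero_lt_top.ne

lemma integrable_exp_logLR : Integrable (fun x => Real.exp (B.logLR x)) (B.law 0) := by
  refine ⟨B.measurable_logLR.exp.aestronglyMeasurable, ?_⟩
  rw [hasFiniteIntegral_iff_ofReal (.of_forall fun x => (Real.exp_pos _).le), ← setLIntegral_univ,
    ← withDensity_apply _ .univ, B.law_zero_withDensity_exp_logLR, measure_univ]
  exact ENNReal.one_lt_top

/-! ### Change of measure -/

lemma P_one_eq_setLIntegral {n : ℕ} {E : Set (ℕ → 𝒳)} (hE : MeasurableSet[obsSigma 𝒳 n] E) :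
    B.P 1 E = ∫⁻ ω in E, ENNReal.ofReal (Real.exp (B.LLR n ω)) ∂(B.P 0) := by
  obtain ⟨s, hs, rfl⟩ := hE
  let g (x : 𝒳) := ENNReal.ofReal (Real.exp (B.logLR x))
  have hg : Measurable g := B.measurable_logLR.exp.ennreal_ofReal
  have hprod : Measurable fun x : Fin n → 𝒳 => ∏ k, g (x k) :=
    Finset.measurable_fun_prod _ fun k _ => hg.comp (measurable_pi_apply k)
  have hlaw : (B.law 0).withDensity g = B.law 1 := B.law_zero_withDensity_exp_logLR
  have : SigmaFinite ((B.law 0).withDensity g) := by rw [hlaw]; infer_instance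
  have hpi : (Measure.pi fun _ : Fin n => B.law 1) =
      (Measure.pi fun _ => B.law 0).withDensity fun x => ∏ k, g (x k) := by
    rw [← pi_withDensity (fun _ : Fin n => B.law 0) fun _ => hg, hlaw]
  rw [← Measure.map_apply (measurable_firstObs n) hs, P_eq_iidLaw, map_firstObs_iidLaw, hpi,
    withDensity_apply _ hs, ← map_firstObs_iidLaw n, setLIntegral_map hs hprod
      (measurable_firstObs n)]
  refine lintegral_congr fun ω => ?_
  rw [LLR_eq_sum, Real.exp_sum, ENNReal.ofReal_prod_of_nonneg fun k _ => (Real.exp_pos _).le]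
  exact Fin.prod_univ_eq_prod_range (fun k => g (ω k)) n

lemma P_zero_le_of_le_LLR {n : ℕ} {E : Set (ℕ → 𝒳)} (hE : MeasurableSet[obsSigma 𝒳 n] E) {a : ℝ}
    (h : ∀ ω ∈ E, a ≤ B.LLR n ω) : B.P 0 E ≤ ENNReal.ofReal (Real.exp (-a)) * B.P 1 E :=
  calc B.P 0 E = ENNReal.ofReal (Real.exp (-a)) *
        ∫⁻ _ in E, ENNReal.ofReal (Real.exp a) ∂(B.P 0) := by
        rw [setLIntegral_const, ← mul_assoc, ← ENNReal.ofReal_mul (Real.exp_pos _).le,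
          ← Real.exp_add, neg_add_cancel, Real.exp_zero, ENNReal.ofReal_one, one_mul]
    _ ≤ ENNReal.ofReal (Real.exp (-a)) * B.P 1 E := by
        rw [B.P_one_eq_setLIntegral hE]
        refine mul_le_mul_right ?_ _
        exact setLIntegral_mono' (obsSigma_le n _ hE) fun ω hω =>
          ENNReal.ofReal_le_ofReal (Real.exp_le_exp.2 (h ω hω))

lemma P_zero_iUnion_le_of_le_LLR {E : ℕ → Set (ℕ → 𝒳)}
    (hE : ∀ n, MeasurableSet[obsSigma 𝒳 n] (E n)) (hdisj : Pairwise (Function.onFun Disjoint E))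
    {a : ℝ} (h : ∀ n, ∀ ω ∈ E n, a ≤ B.LLR n ω) :
    B.P 0 (⋃ n, E n) ≤ ENNReal.ofReal (Real.exp (-a)) * B.P 1 (⋃ n, E n) := by
  rw [measure_iUnion hdisj fun n => obsSigma_le n _ (hE n),
    measure_iUnion hdisj fun n => obsSigma_le n _ (hE n), ← ENNReal.tsum_mul_left]
  exact ENNReal.tsum_le_tsum fun n => B.P_zero_le_of_le_LLR (hE n) (h n)

end BinaryProblem

/-! ### The lower bound on expected sample sizes -/

/-- The same sample size with the opposite decision. -/
def TestRule.swap {𝒳 : Type*} (τ : TestRule 𝒳) : TestRule 𝒳 where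
  T := τ.T
  D := fun ω => 1 - τ.D ω

lemma TestRule.swap_D_eq_iff {𝒳 : Type*} (τ : TestRule 𝒳) (ω : ℕ → 𝒳) (i : Fin 2) :
    τ.swap.D ω = i ↔ τ.D ω = 1 - i :=
  sub_eq_iff_eq_add.trans (by rw [eq_sub_iff_add_eq, add_comm, eq_comm])

/-- The filter of pairs `(α, β)` with `α, β → 0` through positive values. -/
abbrev smallLevels : Filter (ℝ × ℝ) := 𝓝[>] (0 : ℝ) ×ˢ 𝓝[>] (0 : ℝ)

lemma eventually_mem_Ioo_smallLevels {ε : ℝ} (hε : 0 < ε) :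
    ∀ᶠ q in smallLevels, q.1 ∈ Set.Ioo 0 ε ∧ q.2 ∈ Set.Ioo 0 ε :=
  prod_mem_prod (Ioo_mem_nhdsGT hε) (Ioo_mem_nhdsGT hε)

lemma tendsto_abs_log_zero : Tendsto (fun x : ℝ => |Real.log x|) (𝓝[>] 0) atTop :=
  tendsto_abs_atBot_atTop.comp Real.tendsto_log_nhdsGT_zero

lemma exp_neg_abs_log {x : ℝ} (hx : x ∈ Set.Ioo (0 : ℝ) 1) : Real.exp (-|Real.log x|) = x := by
  rw [abs_of_neg (Real.log_neg hx.1 hx.2), neg_neg, Real.exp_log hx.1]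

namespace BinaryProblem

variable {𝒳 : Type*} [MeasurableSpace 𝒳] (B : BinaryProblem 𝒳)

section Tests

variable {B} {τ : TestRule 𝒳}

lemma IsTest.measurable_T (hτ : B.IsTest τ) : Measurable τ.T :=
  ENat.measurable_iff.2 fun n => obsSigma_le n _ (hτ.stopping n)

lemma IsTest.swap (hτ : B.IsTest τ) : B.swap.IsTest τ.swap where
  one_le := hτ.one_le
  stopping := hτ.stopping
  decision n i := by
    simp only [TestRule.swap_D_eq_iff]
    exact hτ.decision n (1 - i)
  measurable_D := (Measurable.of_discrete (f := fun d : Fin 2 => 1 - d)).comp hτ.measurable_D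
  finite := Fin.forall_fin_two.2 ⟨hτ.finite 1, hτ.finite 0⟩

lemma swap_mem_testClass {α β : ℝ} (hτ : τ ∈ B.testClass α β) :
    τ.swap ∈ B.swap.testClass β α := by
  refine ⟨hτ.1.swap, ?_, ?_⟩
  · simp only [TestRule.swap_D_eq_iff]
    exact hτ.2.2
  · simp only [TestRule.swap_D_eq_iff]
    exact hτ.2.1

lemma IsTest.P_zero_sampleSize_le (hτ : B.IsTest τ) (n : ℕ) (a : ℝ) :
    B.P 0 {ω | τ.T ω ≤ n} ≤ B.P 0 {ω | τ.D ω = 1} +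
      ENNReal.ofReal (Real.exp a) * B.P 1 {ω | τ.D ω = 0} +
      B.P 0 {ω | ∃ k ≤ n, B.LLR k ω < -a} := by
  let accepts (k : ℕ) : Set (ℕ → 𝒳) := {ω | τ.T ω = k ∧ τ.D ω = 0} ∩ {ω | -a ≤ B.LLR k ω}
  have haccepts : B.P 0 (⋃ k, accepts k) ≤
      ENNReal.ofReal (Real.exp a) * B.P 1 {ω | τ.D ω = 0} := by
    have h := B.P_zero_iUnion_le_of_le_LLR (E := accepts) (a := -a)
      (fun k => (hτ.decision k 0).inter
        (measurableSet_le measurable_const (B.measurable_obsSigma_LLR le_rfl)))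
      (fun i j hij => Set.disjoint_left.2 fun ω hi hj =>
        hij (Nat.cast_injective (hi.1.1.symm.trans hj.1.1)))
      fun k ω hω => hω.2
    rw [neg_neg] at h
    refine h.trans (mul_le_mul_right (measure_mono ?_) _)
    exact Set.iUnion_subset fun k ω hω => hω.1.2
  have hsubset : {ω | τ.T ω ≤ n} ⊆ ({ω | τ.D ω = 1} ∪ ⋃ k, accepts k) ∪
      {ω | ∃ k ≤ n, B.LLR k ω < -a} := by
    intro ω hω
    obtain ⟨k, hk⟩ := ENat.ne_top_iff_exists.1 (ne_top_of_le_ne_top (ENat.natCast_ne_top n) hω)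
    have hkn : k ≤ n := Nat.cast_le.1 (hk.trans_le hω)
    rcases lt_or_ge (B.LLR k ω) (-a) with hlt | hge
    · exact .inr ⟨k, hkn, hlt⟩
    · rcases Fin.exists_fin_two.1 ⟨τ.D ω, rfl⟩ with hD | hD
      · exact .inl (.inr (Set.mem_iUnion.2 ⟨k, ⟨hk.symm, hD⟩, hge⟩))
      · exact .inl (.inl hD)
  calc B.P 0 {ω | τ.T ω ≤ n} ≤ _ := measure_mono hsubset
    _ ≤ B.P 0 {ω | τ.D ω = 1} + B.P 0 (⋃ k, accepts k) + B.P 0 {ω | ∃ k ≤ n, B.LLR k ω < -a} :=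
        (measure_union_le _ _).trans (add_le_add_left (measure_union_le _ _) _)
    _ ≤ _ := by gcongr

end Tests

lemma tendsto_P_zero_exists_LLR_lt {c : ℝ} (hc : B.info < c) :
    Tendsto (fun n : ℕ => B.P 0 {ω | ∃ k ≤ n, B.LLR k ω < -(c * n)}) atTop (𝓝 0) := by
  have h := tendsto_measure_exists_sum_gt B.measurable_logLR.neg B.integrable_logLR.neg
    (B.info_pos.trans hc) hc
  simp only [Pi.neg_apply, Finset.sum_neg_distrib, lt_neg (a := c * _)] at h
  exact h

lemma eventually_P_zero_sampleSize_le {κ δ : ℝ} (hκ : κ ∈ Set.Ioo (0 : ℝ) 1) (hδ : 0 < δ) :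
    ∀ᶠ q in smallLevels, ∀ τ ∈ B.testClass q.1 q.2,
      B.P 0 {ω | τ.T ω ≤ (⌊κ * (|Real.log q.2| / B.info)⌋₊ : ℕ)} ≤ ENNReal.ofReal δ := by
  have hI := B.info_pos
  obtain ⟨c, hIc, hc⟩ := exists_between ((lt_div_iff₀ hκ.1).2 (mul_lt_of_lt_one_right hI hκ.2))
  have hcκ : κ * c / B.info < 1 := by rwa [div_lt_one hI, ← lt_div_iff₀' hκ.1]
  let n (q : ℝ × ℝ) : ℕ := ⌊κ * (|Real.log q.2| / B.info)⌋₊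
  have hL : Tendsto (fun q : ℝ × ℝ => |Real.log q.2|) smallLevels atTop :=
    tendsto_abs_log_zero.comp tendsto_snd
  have hn : Tendsto n smallLevels atTop :=
    tendsto_nat_floor_atTop.comp ((hL.atTop_div_const hI).const_mul_atTop hκ.1)
  have hreject : Tendsto (fun q : ℝ × ℝ => ENNReal.ofReal q.1) smallLevels (𝓝 0) := by
    simpa using ENNReal.tendsto_ofReal (a := 0) (tendsto_fst.mono_right nhdsWithin_le_nhds)
  have haccept : Tendsto (fun q : ℝ × ℝ =>
      ENNReal.ofReal (Real.exp ((κ * c / B.info - 1) * |Real.log q.2|))) smallLevels (𝓝 0) := by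
    simpa using ENNReal.tendsto_ofReal
      (Real.tendsto_exp_atBot.comp (hL.const_mul_atTop_of_neg (sub_neg.2 hcκ)))
  have hlim := (hreject.add haccept).add ((B.tendsto_P_zero_exists_LLR_lt hIc).comp hn)
  simp only [add_zero] at hlim
  filter_upwards [hlim.eventually (gt_mem_nhds (ENNReal.ofReal_pos.2 hδ)),
    eventually_mem_Ioo_smallLevels one_pos] with q hq hq1 τ hτ
  have hcn : c * n q ≤ κ * c / B.info * |Real.log q.2| :=
    calc c * n q ≤ c * (κ * (|Real.log q.2| / B.info)) :=
          mul_le_mul_of_nonneg_left (Nat.floor_le (by have := hκ.1; positivity))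
            (hI.trans hIc).le
      _ = κ * c / B.info * |Real.log q.2| := by ring
  refine ((hτ.1.P_zero_sampleSize_le (n q) (c * n q)).trans ?_).trans hq.le
  refine add_le_add_left (add_le_add hτ.2.1 ?_) _
  calc ENNReal.ofReal (Real.exp (c * n q)) * B.P 1 {ω | τ.D ω = 0}
      ≤ ENNReal.ofReal (Real.exp (κ * c / B.info * |Real.log q.2|)) * ENNReal.ofReal q.2 := by
        gcongr
        exact hτ.2.2
    _ = ENNReal.ofReal (Real.exp ((κ * c / B.info - 1) * |Real.log q.2|)) := by
        rw [← ENNReal.ofReal_mul (Real.exp_pos _).le, sub_mul, one_mul, sub_eq_add_neg,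
          Real.exp_add, exp_neg_abs_log hq1.2]

/-- The first-order approximation, as the levels `q = (α, β)` vanish, to the smallest expected
sample size under `P i` of a test with these levels: `|log β| / I₀` for `i = 0` and
`|log α| / I₁` for `i = 1`. -/
def firstOrderESS (q : ℝ × ℝ) (i : Fin 2) : ℝ :=
  ![|Real.log q.2| / B.info, |Real.log q.1| / B.swap.info] i

lemma eventually_firstOrderESS_zero_le {κ : ℝ} (hκ : κ ∈ Set.Ioo (0 : ℝ) 1) :
    ∀ᶠ q in smallLevels, ∀ τ ∈ B.testClass q.1 q.2,
      ENNReal.ofReal (κ * B.firstOrderESS q 0) ≤ ∫⁻ ω, (τ.T ω : ℝ≥0∞) ∂(B.P 0) := by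
  obtain ⟨κ', hκκ', hκ'⟩ := exists_between hκ.2
  have hκ'0 : 0 < κ' := hκ.1.trans hκκ'
  have hratio : κ / κ' < 1 := (div_lt_one hκ'0).2 hκκ'
  filter_upwards [B.eventually_P_zero_sampleSize_le ⟨hκ'0, hκ'⟩ (sub_pos.2 hratio)] with q hq τ hτ
  set n : ℕ := ⌊κ' * (|Real.log q.2| / B.info)⌋₊
  have hmeas : Measurable fun ω => (τ.T ω : ℝ≥0∞) :=
    (Measurable.of_discrete (f := ENat.toENNReal)).comp hτ.1.measurable_T
  have hcompl : {ω | ((n + 1 : ℕ) : ℝ≥0∞) ≤ (τ.T ω : ℝ≥0∞)} = {ω | τ.T ω ≤ n}ᶜ := by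
    ext ω
    simp only [Set.mem_ofPred_eq, Set.mem_compl_iff, not_le]
    rw [← ENat.toENNReal_coe, ENat.toENNReal_le]
    push_cast
    exact ENat.add_one_le_iff (ENat.natCast_ne_top _)
  have hprob : ENNReal.ofReal (κ / κ') ≤ B.P 0 {ω | ((n + 1 : ℕ) : ℝ≥0∞) ≤ (τ.T ω : ℝ≥0∞)} := by
    have hle : MeasurableSet {ω | τ.T ω ≤ n} :=
      hτ.1.measurable_T (.of_discrete (s := Set.Iic (n : ℕ∞)))
    rw [hcompl, prob_compl_eq_one_sub hle]
    refine le_trans (le_of_eq ?_) (tsub_le_tsub_left (hq τ hτ) 1)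
    rw [← ENNReal.ofReal_one, ← ENNReal.ofReal_sub _ (sub_nonneg.2 hratio.le), sub_sub_cancel]
  calc ENNReal.ofReal (κ * B.firstOrderESS q 0)
      ≤ ENNReal.ofReal ((n + 1 : ℕ) * (κ / κ')) := by
        refine ENNReal.ofReal_le_ofReal ?_
        have hfloor : κ' * B.firstOrderESS q 0 ≤ (n + 1 : ℕ) := by
          push_cast
          exact (Nat.lt_floor_add_one _).le
        calc κ * B.firstOrderESS q 0 = κ' * B.firstOrderESS q 0 * (κ / κ') := by field_simp
          _ ≤ (n + 1 : ℕ) * (κ / κ') := by have := hκ.1; gcongr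
    _ = (n + 1 : ℕ) * ENNReal.ofReal (κ / κ') := by
        rw [ENNReal.ofReal_mul (Nat.cast_nonneg _), ENNReal.ofReal_natCast]
    _ ≤ (n + 1 : ℕ) * B.P 0 {ω | ((n + 1 : ℕ) : ℝ≥0∞) ≤ (τ.T ω : ℝ≥0∞)} := by gcongr
    _ ≤ ∫⁻ ω, (τ.T ω : ℝ≥0∞) ∂(B.P 0) := mul_meas_ge_le_lintegral hmeas _

lemma eventually_firstOrderESS_le {κ : ℝ} (hκ : κ ∈ Set.Ioo (0 : ℝ) 1) :
    ∀ᶠ q in smallLevels, ∀ τ ∈ B.testClass q.1 q.2, ∀ i,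
      ENNReal.ofReal (κ * B.firstOrderESS q i) ≤ ∫⁻ ω, (τ.T ω : ℝ≥0∞) ∂(B.P i) := by
  filter_upwards [B.eventually_firstOrderESS_zero_le hκ,
    tendsto_prod_swap.eventually (B.swap.eventually_firstOrderESS_zero_le hκ)] with q h0 h1 τ hτ
  exact Fin.forall_fin_two.2 ⟨h0 τ hτ, h1 τ.swap (swap_mem_testClass hτ)⟩

end BinaryProblem

/-! ### A criterion for asymptotic optimality -/

lemma one_sub_rpow_one_div_mem_Ioo {α : ℝ} {N : ℕ} (hN : N ≠ 0) (hα : α ∈ Set.Ioo (0 : ℝ) 1) :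
    1 - (1 - α) ^ (1 / (N : ℝ)) ∈ Set.Ioo (0 : ℝ) 1 := by
  have hpos : 0 < 1 - α := sub_pos.2 hα.2
  exact ⟨sub_pos.2 (Real.rpow_lt_one hpos.le (by linarith [hα.1]) (by positivity)),
    sub_lt_self 1 (Real.rpow_pos_of_pos hpos _)⟩

lemma tendsto_one_sub_rpow_one_div {α : ℝ} (hα : α ∈ Set.Ioo (0 : ℝ) 1) {N : ℕ → ℕ}
    (hN : Tendsto N atTop atTop) :
    Tendsto (fun m => 1 - (1 - α) ^ (1 / (N m : ℝ))) atTop (𝓝[>] 0) := by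
  refine tendsto_nhdsWithin_iff.2 ⟨?_, ?_⟩
  · have h := ((Real.continuous_const_rpow (sub_pos.2 hα.2).ne').tendsto 0).comp
      (tendsto_one_div_atTop_nhds_zero_nat.comp hN)
    simpa using h.const_sub 1
  · filter_upwards [hN.eventually_gt_atTop 0] with m hm
    exact (one_sub_rpow_one_div_mem_Ioo hm.ne' hα).1

lemma tendsto_levels {α β : ℝ} (hα : α ∈ Set.Ioo (0 : ℝ) 1) (hβ : β ∈ Set.Ioo (0 : ℝ) 1)
    {l u : ℕ → ℕ} (hu : Tendsto u atTop atTop)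
    (hl : Tendsto (fun m : ℕ => m - l m) atTop atTop) :
    Tendsto (fun m => (levelI m (l m) α, levelII (u m) β)) atTop smallLevels := by
  refine Tendsto.prodMk ?_ (tendsto_one_sub_rpow_one_div hβ hu)
  refine (tendsto_one_sub_rpow_one_div hα hl).congr' ?_
  filter_upwards [hl.eventually_gt_atTop 0] with m hm
  rw [levelI, Nat.cast_sub (Nat.lt_of_sub_pos hm).le]

namespace BinaryProblem

variable {𝒳 : Type*} [MeasurableSpace 𝒳] (B : BinaryProblem 𝒳)

/-- A family of tests attains the first-order approximation to the smallest expected sample size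
under both hypotheses. -/
def FirstOrderOptimal (χ : ℝ → ℝ → TestRule 𝒳) : Prop :=
  ∀ i, ∀ r : ℝ, 1 < r → ∀ᶠ q in smallLevels,
    ∫⁻ ω, ((χ q.1 q.2).T ω : ℝ≥0∞) ∂(B.P i) ≤ ENNReal.ofReal (r * B.firstOrderESS q i)

lemma ess_eq (π : ℝ) (τ : TestRule 𝒳) :
    B.ess π τ = ENNReal.ofReal (1 - π) * ∫⁻ ω, (τ.T ω : ℝ≥0∞) ∂(B.P 0) +
      ENNReal.ofReal π * ∫⁻ ω, (τ.T ω : ℝ≥0∞) ∂(B.P 1) := by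
  rw [ess, mixture, lintegral_add_measure, lintegral_smul_measure, lintegral_smul_measure,
    smul_eq_mul, smul_eq_mul]

variable {B}

lemma IsTest.one_le_ess {τ : TestRule 𝒳} (hτ : B.IsTest τ) (π : ℝ) : 1 ≤ B.ess π τ := by
  have hone (i : Fin 2) : 1 ≤ ∫⁻ ω, (τ.T ω : ℝ≥0∞) ∂(B.P i) :=
    calc (1 : ℝ≥0∞) = ∫⁻ _, 1 ∂(B.P i) := by rw [lintegral_one, measure_univ]
      _ ≤ ∫⁻ ω, (τ.T ω : ℝ≥0∞) ∂(B.P i) := lintegral_mono fun ω => by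
          rw [← ENat.toENNReal_one, ENat.toENNReal_le]
          exact hτ.one_le ω
  rw [ess_eq]
  calc (1 : ℝ≥0∞) = ENNReal.ofReal (1 - π + π) := by rw [sub_add_cancel, ENNReal.ofReal_one]
    _ ≤ ENNReal.ofReal (1 - π) * 1 + ENNReal.ofReal π * 1 := by
        rw [mul_one, mul_one]
        exact ENNReal.ofReal_add_le
    _ ≤ _ := by gcongr <;> exact hone _

lemma one_le_ess_div_optESS {τ : TestRule 𝒳} {α β : ℝ} (hτ : τ ∈ B.testClass α β)
    (hfin : ∀ i, ∫⁻ ω, (τ.T ω : ℝ≥0∞) ∂(B.P i) ≠ ⊤) (π : ℝ) :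
    1 ≤ B.ess π τ / B.optESS π α β := by
  have hess : B.ess π τ ≠ ⊤ := by
    rw [ess_eq]
    exact ENNReal.add_ne_top.2 ⟨ENNReal.mul_ne_top ENNReal.ofReal_ne_top (hfin 0),
      ENNReal.mul_ne_top ENNReal.ofReal_ne_top (hfin 1)⟩
  rw [ENNReal.le_div_iff_mul_le (.inr (one_pos.trans_le (hτ.1.one_le_ess π)).ne') (.inr hess),
    one_mul]
  exact iInf₂_le τ hτ

lemma ess_le_mul_optESS {χ : TestRule 𝒳} {α β : ℝ} {c : ℝ≥0∞} (hc : c ≠ 0) (hc' : c ≠ ⊤)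
    (h : ∀ τ ∈ B.testClass α β, ∀ i,
      ∫⁻ ω, (χ.T ω : ℝ≥0∞) ∂(B.P i) ≤ c * ∫⁻ ω, (τ.T ω : ℝ≥0∞) ∂(B.P i)) (π : ℝ) :
    B.ess π χ ≤ c * B.optESS π α β := by
  rw [mul_comm, ← ENNReal.div_le_iff_le_mul (.inl hc) (.inl hc')]
  refine le_iInf₂ fun τ hτ => ?_
  rw [ENNReal.div_le_iff_le_mul (.inl hc) (.inl hc'), mul_comm, ess_eq, ess_eq, mul_add,
    mul_left_comm c, mul_left_comm c]
  gcongr <;> exact h τ hτ _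

lemma FirstOrderOptimal.eventually_ess_le {χ : ℝ → ℝ → TestRule 𝒳} (hχ : B.FirstOrderOptimal χ)
    {r : ℝ} (hr : 1 < r) :
    ∀ᶠ q in smallLevels, ∀ π, B.ess π (χ q.1 q.2) ≤ ENNReal.ofReal r * B.optESS π q.1 q.2 := by
  have hr0 : 0 < r := one_pos.trans hr
  obtain ⟨κ, hrκ, hκ1⟩ := exists_between (inv_lt_one_of_one_lt₀ hr)
  have hrκ' : 1 < r * κ := (inv_lt_iff_one_lt_mul₀' hr0).1 hrκ
  have hκ : κ ∈ Set.Ioo (0 : ℝ) 1 := ⟨(inv_pos.2 hr0).trans hrκ, hκ1⟩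
  filter_upwards [hχ 0 _ hrκ', hχ 1 _ hrκ', B.eventually_firstOrderESS_le hκ] with q h0 h1 hlow
  refine ess_le_mul_optESS (ENNReal.ofReal_pos.2 hr0).ne' ENNReal.ofReal_ne_top fun τ hτ i => ?_
  have hup : ∫⁻ ω, ((χ q.1 q.2).T ω : ℝ≥0∞) ∂(B.P i) ≤
      ENNReal.ofReal (r * κ * B.firstOrderESS q i) := by
    fin_cases i
    exacts [h0, h1]
  refine hup.trans ?_
  rw [mul_assoc, ENNReal.ofReal_mul hr0.le]
  gcongr
  exact hlow τ hτ i

theorem FirstOrderOptimal.highDimOptimal {χ : ℝ → ℝ → TestRule 𝒳} (hχ : B.FirstOrderOptimal χ)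
    (hmem : ∀ α ∈ Set.Ioo (0 : ℝ) 1, ∀ β ∈ Set.Ioo (0 : ℝ) 1, χ α β ∈ B.testClass α β)
    {l u : ℕ → ℕ} (hlu : ∀ᶠ m in atTop, l m ≤ u m) (hu : Tendsto u atTop atTop)
    (hl : Tendsto (fun m : ℕ => m - l m) atTop atTop) :
    B.HighDimOptimal l u χ := by
  refine ⟨hmem, fun α hα β hβ => tendsto_order.2 ⟨fun a ha => ?_, fun b hb => ?_⟩⟩
  all_goals have hlevels := tendsto_levels hα hβ hu hl
  · filter_upwards [hlu, hlevels.eventually (eventually_mem_Ioo_smallLevels one_pos),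
      hlevels.eventually (hχ 0 2 one_lt_two), hlevels.eventually (hχ 1 2 one_lt_two)]
      with m hm hIoo h0 h1
    have hfin : ∀ i, ∫⁻ ω, ((χ (levelI m (l m) α) (levelII (u m) β)).T ω : ℝ≥0∞) ∂(B.P i) ≠ ⊤ :=
      Fin.forall_fin_two.2 ⟨ne_top_of_le_ne_top ENNReal.ofReal_ne_top h0,
        ne_top_of_le_ne_top ENNReal.ofReal_ne_top h1⟩
    exact ha.trans_le ((one_le_ess_div_optESS (hmem _ hIoo.1 _ hIoo.2) hfin _).trans
      (Finset.le_sup (f := fun s : ℕ => B.ess ((s : ℝ) / m) _ / B.optESS ((s : ℝ) / m) _ _)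
        (Finset.left_mem_Icc.2 hm)))
  · obtain ⟨r, hr1, hrb⟩ := ENNReal.lt_iff_exists_nnreal_btwn.1 hb
    have hr1 : (1 : ℝ) < r := by exact_mod_cast hr1
    filter_upwards [hlevels.eventually (hχ.eventually_ess_le hr1)] with m hm
    refine lt_of_le_of_lt (Finset.sup_le fun s _ => ENNReal.div_le_of_le_mul ?_) hrb
    rw [← ENNReal.ofReal_coe_nnreal]
    exact hm _

end BinaryProblem

/-! ### Familywise error control -/

lemma pi_exists_mem {ι : Type*} [Fintype ι] {Ω : ι → Type*} [∀ i, MeasurableSpace (Ω i)]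
    (μ : ∀ i, Measure (Ω i)) [∀ i, IsProbabilityMeasure (μ i)] {G : ∀ i, Set (Ω i)}
    (hG : ∀ i, MeasurableSet (G i)) (S : Finset ι) :
    Measure.pi μ {x | ∃ i ∈ S, x i ∈ G i} = 1 - ∏ i ∈ S, (1 - μ i (G i)) := by
  have hcompl : {x : ∀ i, Ω i | ∃ i ∈ S, x i ∈ G i} = ((S : Set ι).pi fun i => (G i)ᶜ)ᶜ := by
    ext x
    simp [Set.mem_pi]
  rw [hcompl, prob_compl_eq_one_sub (.pi S.countable_toSet fun i _ => (hG i).compl),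
    ← Measure.infinitePi_eq_pi, Measure.infinitePi_pi μ fun i _ => (hG i).compl,
    Finset.prod_congr rfl fun i _ => prob_compl_eq_one_sub (hG i)]

lemma one_sub_one_sub_pow_le_ofReal_iff {p : ℝ≥0∞} (hp : p ≤ 1) {N : ℕ} (hN : N ≠ 0) {α : ℝ}
    (hα : α ∈ Set.Ioo (0 : ℝ) 1) :
    1 - (1 - p) ^ N ≤ ENNReal.ofReal α ↔ p ≤ ENNReal.ofReal (1 - (1 - α) ^ (1 / (N : ℝ))) := by
  lift p to NNReal using ne_top_of_le_ne_top ENNReal.one_ne_top hp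
  have hp' : (p : ℝ) ≤ 1 := by exact_mod_cast hp
  have hroot : (1 - α) ^ (1 / (N : ℝ)) ≤ 1 - p ↔ 1 - α ≤ (1 - p) ^ N := by
    rw [one_div, Real.rpow_inv_le_iff_of_pos (sub_nonneg.2 hα.2.le) (sub_nonneg.2 hp')
      (by positivity), Real.rpow_natCast]
  rw [← ENNReal.ofReal_coe_nnreal, ← ENNReal.ofReal_one, ← ENNReal.ofReal_sub 1 p.coe_nonneg,
    ← ENNReal.ofReal_pow (sub_nonneg.2 hp'),
    ← ENNReal.ofReal_sub _ (pow_nonneg (sub_nonneg.2 hp') N), ENNReal.ofReal_le_ofReal_iff hα.1.le,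
    ENNReal.ofReal_le_ofReal_iff (one_sub_rpow_one_div_mem_Ioo hN hα).1.le, sub_le_comm, ← hroot,
    le_sub_comm]

namespace BinaryProblem

variable {𝒳 : Type*} [MeasurableSpace 𝒳] {B : BinaryProblem 𝒳} {τ : TestRule 𝒳} {m : ℕ}

lemma IsTest.measurableSet_D_eq (hτ : B.IsTest τ) (i : Fin 2) : MeasurableSet {ω | τ.D ω = i} :=
  hτ.measurable_D (measurableSet_singleton i)

lemma IsTest.fweI_eq (hτ : B.IsTest τ) (A : Finset (Fin m)) :
    B.fweI A τ = 1 - (1 - B.P 0 {ω | τ.D ω = 1}) ^ (m - A.card) := by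
  have h := pi_exists_mem (fun j : Fin m => B.P (if j ∈ A then 1 else 0))
    (fun _ => hτ.measurableSet_D_eq 1) Aᶜ
  rw [Finset.prod_congr rfl fun j hj => by rw [if_neg (Finset.mem_compl.1 hj)],
    Finset.prod_const, Finset.card_compl, Fintype.card_fin] at h
  simp only [Finset.mem_compl] at h
  exact h

lemma IsTest.fweII_eq (hτ : B.IsTest τ) (A : Finset (Fin m)) :
    B.fweII A τ = 1 - (1 - B.P 1 {ω | τ.D ω = 0}) ^ A.card := by
  have h := pi_exists_mem (fun j : Fin m => B.P (if j ∈ A then 1 else 0))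
    (fun _ => hτ.measurableSet_D_eq 0) A
  rwa [Finset.prod_congr rfl fun j hj => by rw [if_pos hj], Finset.prod_const] at h

lemma IsTest.forall_fweI_le_iff (hτ : B.IsTest τ) {l u : ℕ} (hlu : l ≤ u) (hlm : l ≤ m)
    (x : ℝ≥0∞) :
    (∀ A : Finset (Fin m), l ≤ A.card → A.card ≤ u → B.fweI A τ ≤ x) ↔
      1 - (1 - B.P 0 {ω | τ.D ω = 1}) ^ (m - l) ≤ x := by
  constructor
  · intro h
    obtain ⟨A, -, hA⟩ := Finset.exists_subset_card_eq
      (hlm.trans_eq (Finset.card_fin m).symm)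
    have hfwe := h A hA.ge (hA.le.trans hlu)
    rwa [hτ.fweI_eq, hA] at hfwe
  · intro h A hlA _
    rw [hτ.fweI_eq]
    exact (tsub_le_tsub_left (pow_le_pow_right_of_le_one' tsub_le_self
      (Nat.sub_le_sub_left hlA m)) 1).trans h

lemma IsTest.forall_fweII_le_iff (hτ : B.IsTest τ) {l u : ℕ} (hlu : l ≤ u) (hum : u ≤ m)
    (x : ℝ≥0∞) :
    (∀ A : Finset (Fin m), l ≤ A.card → A.card ≤ u → B.fweII A τ ≤ x) ↔
      1 - (1 - B.P 1 {ω | τ.D ω = 0}) ^ u ≤ x := by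
  constructor
  · intro h
    obtain ⟨A, -, hA⟩ := Finset.exists_subset_card_eq
      (hum.trans_eq (Finset.card_fin m).symm)
    have hfwe := h A (hlu.trans hA.ge) hA.le
    rwa [hτ.fweII_eq, hA] at hfwe
  · intro h A _ hAu
    rw [hτ.fweII_eq]
    exact (tsub_le_tsub_left (pow_le_pow_right_of_le_one' tsub_le_self hAu) 1).trans h

variable (B)

theorem fweClass_eq_testClass {l u : ℕ} (hlu : l ≤ u) (hum : u ≤ m) (hu : 0 < u) (hlm : l < m)
    {α β : ℝ} (hα : α ∈ Set.Ioo (0 : ℝ) 1) (hβ : β ∈ Set.Ioo (0 : ℝ) 1) :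
    B.fweClass m l u α β = B.testClass (levelI m l α) (levelII u β) := by
  ext τ
  refine and_congr_right fun hτ => ?_
  rw [levelI, ← Nat.cast_sub hlm.le, levelII,
    ← one_sub_one_sub_pow_le_ofReal_iff prob_le_one (Nat.sub_ne_zero_of_lt hlm) hα,
    ← one_sub_one_sub_pow_le_ofReal_iff prob_le_one hu.ne' hβ,
    ← hτ.forall_fweI_le_iff hlu hlm.le, ← hτ.forall_fweII_le_iff hlu hum]
  simp only [forall_and]

variable {B}

lemma IsTest.lintegral_streamLaw (hτ : B.IsTest τ) (A : Finset (Fin m)) (j : Fin m) :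
    ∫⁻ x, (τ.T (x j) : ℝ≥0∞) ∂(B.streamLaw m A) =
      ∫⁻ ω, (τ.T ω : ℝ≥0∞) ∂(B.P (if j ∈ A then 1 else 0)) :=
  (measurePreserving_eval (fun j : Fin m => B.P (if j ∈ A then 1 else 0)) j).lintegral_comp
    ((Measurable.of_discrete (f := ENat.toENNReal)).comp hτ.measurable_T)

theorem IsTest.avgESS_eq_ess (hτ : B.IsTest τ) (hm : 0 < m) (A : Finset (Fin m)) :
    B.avgESS A τ = B.ess ((A.card : ℝ) / m) τ := by
  have hm0 : (0 : ℝ) < m := Nat.cast_pos.2 hm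
  have hAm : A.card ≤ m := A.card_le_univ.trans_eq (Fintype.card_fin m)
  have hweight (k : ℕ) : ENNReal.ofReal ((k : ℝ) / m) = (m : ℝ≥0∞)⁻¹ * k := by
    rw [ENNReal.ofReal_div_of_pos hm0, ENNReal.ofReal_natCast, ENNReal.ofReal_natCast,
      div_eq_mul_inv, mul_comm]
  have hsum : ∑ j, ∫⁻ x, (τ.T (x j) : ℝ≥0∞) ∂(B.streamLaw m A) =
      (m - A.card : ℕ) * ∫⁻ ω, (τ.T ω : ℝ≥0∞) ∂(B.P 0) +
        A.card * ∫⁻ ω, (τ.T ω : ℝ≥0∞) ∂(B.P 1) := by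
    rw [← Finset.sum_compl_add_sum A,
      Finset.sum_congr rfl fun j hj => by
        rw [hτ.lintegral_streamLaw, if_neg (Finset.mem_compl.1 hj)],
      Finset.sum_congr (s₁ := A) rfl fun j hj => by rw [hτ.lintegral_streamLaw, if_pos hj],
      Finset.sum_const, Finset.sum_const, Finset.card_compl, Fintype.card_fin, nsmul_eq_mul,
      nsmul_eq_mul]
  rw [avgESS, ess_eq, one_sub_div hm0.ne', ← Nat.cast_sub hAm, hweight, hweight, hsum, mul_add,
    mul_assoc, mul_assoc]

end BinaryProblem

/-! ### The SPRT -/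

namespace BinaryProblem

variable {𝒳 : Type*} [MeasurableSpace 𝒳] (B : BinaryProblem 𝒳)

section Tests

variable {B} {τ : TestRule 𝒳}

lemma isTest_of_measurableSet_reject (hone : ∀ ω, 1 ≤ τ.T ω)
    (hT : IsStoppingTime (obsFiltration 𝒳) τ.T) (hfin : ∀ i, ∀ᵐ ω ∂(B.P i), τ.T ω < ⊤)
    (hreject : ∀ n : ℕ, MeasurableSet[obsSigma 𝒳 n] {ω | τ.T ω = n ∧ τ.D ω = 1})
    (htop : ∀ ω, τ.D ω = 1 → τ.T ω < ⊤) : B.IsTest τ where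
  one_le := hone
  stopping := hT.measurableSet_eq
  finite := hfin
  decision n := by
    refine Fin.forall_fin_two.2 ⟨?_, hreject n⟩
    have hdiff : {ω | τ.T ω = n ∧ τ.D ω = 0} = {ω | τ.T ω = n} \ {ω | τ.T ω = n ∧ τ.D ω = 1} := by
      ext ω
      simp only [Set.mem_ofPred_eq, Set.mem_sdiff]
      lia
    rw [hdiff]
    exact (hT.measurableSet_eq n).diff (hreject n)
  measurable_D := by
    have hone_iff : {ω | τ.D ω = 1} = ⋃ n : ℕ, {ω | τ.T ω = n ∧ τ.D ω = 1} := by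
      ext ω
      simp only [Set.mem_ofPred_eq, Set.mem_iUnion, exists_and_right, iff_and_self]
      exact fun h => (ENat.ne_top_iff_exists.1 (htop ω h).ne).imp fun _ => Eq.symm
    have hmeas : MeasurableSet {ω | τ.D ω = 1} := by
      rw [hone_iff]
      exact .iUnion fun n => obsSigma_le n _ (hreject n)
    have hzero : {ω | τ.D ω = 0} = {ω | τ.D ω = 1}ᶜ := by
      ext ω
      simp only [Set.mem_ofPred_eq, Set.mem_compl_iff]
      lia
    have hmeas_zero : MeasurableSet {ω | τ.D ω = 0} := hzero ▸ hmeas.compl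
    exact measurable_to_countable' (Fin.forall_fin_two.2 ⟨hmeas_zero, hmeas⟩)

lemma IsTest.P_zero_reject_le (hτ : B.IsTest τ) {a : ℝ}
    (h : ∀ ω, ∀ n : ℕ, τ.T ω = n → τ.D ω = 1 → a ≤ B.LLR n ω) :
    B.P 0 {ω | τ.D ω = 1} ≤ ENNReal.ofReal (Real.exp (-a)) := by
  have hunion : {ω | τ.D ω = 1} ≤ᵐ[B.P 0] ⋃ n : ℕ, {ω | τ.T ω = n ∧ τ.D ω = 1} := by
    filter_upwards [hτ.finite 0] with ω hω hD
    obtain ⟨n, hn⟩ := ENat.ne_top_iff_exists.1 hω.ne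
    exact Set.mem_iUnion.2 ⟨n, hn.symm, hD⟩
  calc B.P 0 {ω | τ.D ω = 1} ≤ B.P 0 (⋃ n : ℕ, {ω | τ.T ω = n ∧ τ.D ω = 1}) :=
        measure_mono_ae hunion
    _ ≤ ENNReal.ofReal (Real.exp (-a)) * B.P 1 (⋃ n : ℕ, {ω | τ.T ω = n ∧ τ.D ω = 1}) :=
        B.P_zero_iUnion_le_of_le_LLR (fun n => hτ.decision n 1)
          (fun i j hij => Set.disjoint_left.2 fun ω hi hj =>
            hij (Nat.cast_injective (hi.1.symm.trans hj.1)))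
          fun n ω hω => h ω n hω.1 hω.2
    _ ≤ ENNReal.ofReal (Real.exp (-a)) := mul_le_of_le_one_right' prob_le_one

lemma IsTest.P_one_accept_le (hτ : B.IsTest τ) {b : ℝ}
    (h : ∀ ω, ∀ n : ℕ, τ.T ω = n → τ.D ω = 0 → B.LLR n ω ≤ -b) :
    B.P 1 {ω | τ.D ω = 0} ≤ ENNReal.ofReal (Real.exp (-b)) := by
  have hswap := hτ.swap.P_zero_reject_le (a := b) fun ω n hT hD => by
    rw [swap_LLR, le_neg]
    exact h ω n hT ((τ.swap_D_eq_iff ω 1).1 hD)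
  simp only [TestRule.swap_D_eq_iff, swap_P_zero] at hswap
  exact hswap

end Tests

lemma sprtTime_eq_hittingAfter (a b : ℝ) :
    B.sprtTime a b = hittingAfter B.LLR (Set.Ioo (-b) a)ᶜ 1 := by
  funext ω
  refine le_antisymm ?_ (le_sInf ?_)
  · rcases eq_or_ne (hittingAfter B.LLR (Set.Ioo (-b) a)ᶜ 1 ω) ⊤ with htop | htop
    · exact htop ▸ le_top
    · have hmem := hittingAfter_mem_set_of_ne_top htop
      have hone : ((1 : ℕ) : ℕ∞) ≤ hittingAfter B.LLR (Set.Ioo (-b) a)ᶜ 1 ω := le_hittingAfter ω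
      obtain ⟨n, hn⟩ := WithTop.ne_top_iff_exists.1 htop
      rw [← hn] at hone hmem ⊢
      exact sInf_le ⟨n, rfl, Nat.cast_le.1 hone, hmem⟩
  · rintro - ⟨n, rfl, hn, hmem⟩
    exact hittingAfter_le_of_mem hn hmem

lemma isStoppingTime_sprtTime (a b : ℝ) : IsStoppingTime (obsFiltration 𝒳) (B.sprtTime a b) := by
  rw [sprtTime_eq_hittingAfter]
  exact Adapted.isStoppingTime_hittingAfter (fun n => B.measurable_obsSigma_LLR le_rfl)
    measurableSet_Ioo.compl

variable {B} in
lemma LLR_notMem_of_sprtTime_eq {a b : ℝ} {ω : ℕ → 𝒳} {n : ℕ} (h : B.sprtTime a b ω = n) :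
    B.LLR n ω ∉ Set.Ioo (-b) a := by
  rw [sprtTime_eq_hittingAfter] at h
  have hmem := hittingAfter_mem_set_of_ne_top (h.trans_ne (ENat.natCast_ne_top n))
  rw [h] at hmem
  exact hmem

lemma swap_sprtTime (a b : ℝ) (ω : ℕ → 𝒳) : B.swap.sprtTime a b ω = B.sprtTime b a ω := by
  simp only [sprtTime, swap_LLR, Set.mem_Ioo, neg_lt_neg_iff, neg_lt (a := B.LLR _ _),
    and_comm (a := B.LLR _ _ < _)]

lemma exists_lintegral_sprtTime_le {c : ℝ} (hc : c ∈ Set.Ioo 0 B.info) :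
    ∃ C, ∀ a b : ℝ, 0 ≤ b →
      ∫⁻ ω, (B.sprtTime a b ω : ℝ≥0∞) ∂(B.P 0) ≤ ENNReal.ofReal ((b + C) / c) := by
  obtain ⟨C, hC⟩ := exists_lintegral_stoppingTime_le B.measurable_logLR.neg
    B.integrable_logLR.neg hc.1 hc.2
  refine ⟨C, fun a b hb => hC _ (B.isStoppingTime_sprtTime a b) b hb fun ω n hn => ?_⟩
  rw [sprtTime_eq_hittingAfter] at hn
  simp only [Pi.neg_apply, Finset.sum_neg_distrib]
  rcases n.eq_zero_or_pos with rfl | hpos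
  · simpa using hb
  · have hmem := notMem_of_lt_hittingAfter hn hpos
    exact (neg_lt.1 (Set.notMem_compl_iff.1 hmem).1).le

lemma eventually_lintegral_sprtTime_le {r : ℝ} (hr : 1 < r) :
    ∀ᶠ b : ℝ in atTop, ∀ a,
      ∫⁻ ω, (B.sprtTime a b ω : ℝ≥0∞) ∂(B.P 0) ≤ ENNReal.ofReal (r * (b / B.info)) := by
  have hI := B.info_pos
  obtain ⟨c, hrc, hcI⟩ := exists_between (div_lt_self hI hr)
  have hc0 : 0 < c := (div_pos hI (one_pos.trans hr)).trans hrc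
  have hrc' : 0 < r * c - B.info := sub_pos.2 ((div_lt_iff₀' (one_pos.trans hr)).1 hrc)
  obtain ⟨C, hC⟩ := B.exists_lintegral_sprtTime_le ⟨hc0, hcI⟩
  filter_upwards [eventually_ge_atTop (C * B.info / (r * c - B.info)), eventually_ge_atTop 0]
    with b hb hb0 a
  rw [div_le_iff₀ hrc'] at hb
  refine (hC a b hb0).trans (ENNReal.ofReal_le_ofReal ?_)
  rw [← mul_div_assoc, div_le_div_iff₀ hc0 hI]
  linarith

lemma ae_sprtTime_lt_top {a b : ℝ} (ha : 0 ≤ a) (hb : 0 ≤ b) (i : Fin 2) :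
    ∀ᵐ ω ∂(B.P i), B.sprtTime a b ω < ⊤ := by
  have hfin (B : BinaryProblem 𝒳) {a b : ℝ} (hb : 0 ≤ b) :
      ∀ᵐ ω ∂(B.P 0), B.sprtTime a b ω < ⊤ := by
    obtain ⟨C, hC⟩ := B.exists_lintegral_sprtTime_le ⟨half_pos B.info_pos, half_lt_self B.info_pos⟩
    have hmeas : Measurable (B.sprtTime a b) :=
      ENat.measurable_iff.2 fun n => obsSigma_le n _
        ((B.isStoppingTime_sprtTime a b).measurableSet_eq n)
    filter_upwards [ae_lt_top ((Measurable.of_discrete (f := ENat.toENNReal)).comp hmeas)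
      (ne_top_of_le_ne_top ENNReal.ofReal_ne_top (hC a b hb))] with ω hω
    exact ENat.toENNReal_lt_top.1 hω
  fin_cases i
  · exact hfin B hb
  · filter_upwards [hfin B.swap (a := b) ha] with ω hω
    rwa [swap_sprtTime] at hω

lemma sprt_D_eq_one_iff {α β : ℝ} {ω : ℕ → 𝒳} {n : ℕ} (hn : (B.sprt α β).T ω = n) :
    (B.sprt α β).D ω = 1 ↔ |Real.log α| ≤ B.LLR n ω := by
  have h : B.sprtTime |Real.log α| |Real.log β| ω = n := hn
  simp [sprt, h]

lemma isTest_sprt (α β : ℝ) : B.IsTest (B.sprt α β) := by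
  have hT := B.isStoppingTime_sprtTime |Real.log α| |Real.log β|
  refine isTest_of_measurableSet_reject (fun ω => ?_) hT
    (B.ae_sprtTime_lt_top (abs_nonneg _) (abs_nonneg _)) (fun n => ?_) fun ω hD => ?_
  · change 1 ≤ B.sprtTime _ _ ω
    rw [sprtTime_eq_hittingAfter]
    exact le_hittingAfter ω
  · have hset : {ω | (B.sprt α β).T ω = n ∧ (B.sprt α β).D ω = 1} =
        {ω | (B.sprt α β).T ω = n} ∩ {ω | |Real.log α| ≤ B.LLR n ω} := by
      ext ω
      exact and_congr_right B.sprt_D_eq_one_iff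
    rw [hset]
    exact (hT.measurableSet_eq n).inter
      (measurableSet_le measurable_const (B.measurable_obsSigma_LLR le_rfl))
  · by_contra htop
    have htop' : B.sprtTime |Real.log α| |Real.log β| ω = ⊤ := not_lt_top_iff.1 htop
    simp [sprt, htop'] at hD

theorem sprt_mem_testClass {α β : ℝ} (hα : α ∈ Set.Ioo (0 : ℝ) 1) (hβ : β ∈ Set.Ioo (0 : ℝ) 1) :
    B.sprt α β ∈ B.testClass α β := by
  have hτ := B.isTest_sprt α β
  have haccept (ω : ℕ → 𝒳) (n : ℕ) (hn : (B.sprt α β).T ω = n) (hD : (B.sprt α β).D ω = 0) :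
      B.LLR n ω ≤ -|Real.log β| := by
    have hlt : B.LLR n ω < |Real.log α| := by
      rw [← not_le, ← B.sprt_D_eq_one_iff hn, hD]
      exact zero_ne_one
    exact not_lt.1 fun h => LLR_notMem_of_sprtTime_eq hn ⟨h, hlt⟩
  have htype_one := hτ.P_zero_reject_le fun ω n hn hD => (B.sprt_D_eq_one_iff hn).1 hD
  have htype_two := hτ.P_one_accept_le haccept
  rw [exp_neg_abs_log hα] at htype_one
  rw [exp_neg_abs_log hβ] at htype_two
  exact ⟨hτ, htype_one, htype_two⟩

theorem firstOrderOptimal_sprt : B.FirstOrderOptimal B.sprt := by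
  refine Fin.forall_fin_two.2 ⟨fun r hr => ?_, fun r hr => ?_⟩
  · filter_upwards [(tendsto_abs_log_zero.comp tendsto_snd).eventually
      (B.eventually_lintegral_sprtTime_le hr)] with q hq
    exact hq |Real.log q.1|
  · filter_upwards [(tendsto_abs_log_zero.comp tendsto_fst).eventually
      (B.swap.eventually_lintegral_sprtTime_le hr)] with q hq
    have h := hq |Real.log q.2|
    simp only [swap_sprtTime] at h
    exact h

end BinaryProblem

/-! ### The fixed-sample-size test -/

/-- A quantitative form of Stein's lemma for the sample size `n a b` needed for levels `a` and `b`: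
the larger `|log b|` drives it at rate `I`, as long as `|log a|` is small relative to `|log b|`. -/
def SteinBound (n : ℝ → ℝ → ℕ) (I r : ℝ) : Prop :=
  ∀ a ∈ Set.Ioo (0 : ℝ) 1, ∀ b ∈ Set.Ioo (0 : ℝ) 1,
    (n a b : ℝ) ≤ max (|Real.log b| / I) (|Real.log a| / r) + 1

lemma exp_neg_mul_le {x I t : ℝ} (hx : x ∈ Set.Ioo (0 : ℝ) 1) (hI : 0 < I)
    (ht : |Real.log x| / I ≤ t) : Real.exp (-(t * I)) ≤ x := by
  calc Real.exp (-(t * I)) ≤ Real.exp (-|Real.log x|) :=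
        Real.exp_le_exp.2 (neg_le_neg ((div_le_iff₀ hI).1 ht))
    _ = x := exp_neg_abs_log hx

lemma measure_iUnion_lt_le {Ω : Type*} [MeasurableSpace Ω] {μ : Measure Ω} {f : Ω → ℝ} {A : ℝ≥0∞}
    {c : ℕ → ℝ} (hc : Antitone c) (h : ∀ k, μ {ω | c k < f ω} ≤ A) :
    μ (⋃ k, {ω | c k < f ω}) ≤ A := by
  have hmono : Monotone fun k => {ω | c k < f ω} := fun _ _ hij _ hω => (hc hij).trans_lt hω
  rw [hmono.measure_iUnion]
  exact iSup_le h

namespace BinaryProblem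

variable {𝒳 : Type*} [MeasurableSpace 𝒳] (B : BinaryProblem 𝒳)

lemma P_one_avgLLR_le (n : ℕ) (c : ℝ) :
    B.P 1 {ω | B.avgLLR n ω ≤ c} ≤ ENNReal.ofReal (Real.exp (n * c)) := by
  rcases n.eq_zero_or_pos with rfl | hn
  · simpa using prob_le_one
  have h := B.swap.P_zero_le_of_le_LLR (n := n) (E := {ω | B.avgLLR n ω ≤ c}) (a := -(n * c))
    (measurableSet_le (B.measurable_obsSigma_avgLLR le_rfl) measurable_const)
    (fun ω hω => by
      rw [swap_LLR, neg_le_neg_iff, ← div_le_iff₀' (Nat.cast_pos.2 hn)]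
      exact hω)
  rw [neg_neg, swap_P_zero, swap_P_one] at h
  exact h.trans (mul_le_of_le_one_right' prob_le_one)

lemma exists_P_zero_le_avgLLR_le {c : ℝ} (hc : -B.info < c) : ∃ r, 0 < r ∧ ∀ n : ℕ,
    B.P 0 {ω | c ≤ B.avgLLR n ω} ≤ ENNReal.ofReal (Real.exp (-(n * r))) := by
  obtain ⟨r, hr, h⟩ := exists_measure_sum_ge_le_exp B.measurable_logLR B.integrable_logLR
    B.integrable_exp_logLR (B.integral_logLR.trans_lt hc)
  refine ⟨r, hr, fun n => ?_⟩
  rcases n.eq_zero_or_pos with rfl | hn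
  · simpa using prob_le_one
  · have hsum (ω : ℕ → 𝒳) (hω : c ≤ B.avgLLR n ω) : n * c ≤ B.LLR n ω :=
      (le_div_iff₀' (Nat.cast_pos.2 hn)).1 hω
    exact (measure_mono hsum).trans (h n)

-- Both error events include the threshold, unlike in `FixedOK`, so that the statement is
-- invariant under exchanging the hypotheses.
lemma exists_fixed_test {I : ℝ} (hI : I ∈ Set.Ioo 0 B.info) : ∃ r, 0 < r ∧
    ∀ a ∈ Set.Ioo (0 : ℝ) 1, ∀ b ∈ Set.Ioo (0 : ℝ) 1, ∃ n : ℕ, 1 ≤ n ∧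
      (n : ℝ) ≤ max (|Real.log b| / I) (|Real.log a| / r) + 1 ∧
      ∃ c, B.P 0 {ω | c ≤ B.avgLLR n ω} ≤ ENNReal.ofReal a ∧
        B.P 1 {ω | B.avgLLR n ω ≤ c} ≤ ENNReal.ofReal b := by
  obtain ⟨r, hr, hP⟩ := B.exists_P_zero_le_avgLLR_le (neg_lt_neg hI.2)
  refine ⟨r, hr, fun a ha b hb => ?_⟩
  set x := max (|Real.log b| / I) (|Real.log a| / r)
  have hx : 0 < x := lt_max_of_lt_left (div_pos (abs_pos.2 (Real.log_neg hb.1 hb.2).ne) hI.1)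
  have hceil : x ≤ ⌈x⌉₊ := Nat.le_ceil x
  refine ⟨⌈x⌉₊, Nat.one_le_ceil_iff.2 hx, (Nat.ceil_lt_add_one hx.le).le, -I, ?_, ?_⟩
  · exact (hP _).trans (ENNReal.ofReal_le_ofReal
      (exp_neg_mul_le ha hr ((le_max_right _ _).trans hceil)))
  · refine (B.P_one_avgLLR_le _ _).trans (ENNReal.ofReal_le_ofReal ?_)
    rw [mul_neg]
    exact exp_neg_mul_le hb hI.1 ((le_max_left _ _).trans hceil)

variable {B} in
lemma fixedOK_of_measure_le {a b c : ℝ} {n : ℕ}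
    (ha : B.P 0 {ω | c ≤ B.avgLLR n ω} ≤ ENNReal.ofReal a)
    (hb : B.P 1 {ω | B.avgLLR n ω ≤ c} ≤ ENNReal.ofReal b) : B.FixedOK a b n c := by
  have hle (ω : ℕ → 𝒳) (hω : c < B.avgLLR n ω) : c ≤ B.avgLLR n ω := hω.le
  exact ⟨(measure_mono hle).trans ha, hb⟩

lemma nStar_le {a b c : ℝ} {n : ℕ} (hn : 1 ≤ n) (h : B.FixedOK a b n c) : B.nStar a b ≤ n :=
  Nat.sInf_le ⟨hn, c, h⟩

theorem exists_steinBound_nStar {I : ℝ} (hI : I ∈ Set.Ioo 0 B.info) :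
    ∃ r, 0 < r ∧ SteinBound B.nStar I r := by
  obtain ⟨r, hr, h⟩ := B.exists_fixed_test hI
  refine ⟨r, hr, fun a ha b hb => ?_⟩
  obtain ⟨n, hn, hle, c, hzero, hone⟩ := h a ha b hb
  exact (Nat.cast_le.2 (B.nStar_le hn (fixedOK_of_measure_le hzero hone))).trans hle

theorem exists_steinBound_nStar_swap {I : ℝ} (hI : I ∈ Set.Ioo 0 B.swap.info) :
    ∃ r, 0 < r ∧ SteinBound (fun a b => B.nStar b a) I r := by
  obtain ⟨r, hr, h⟩ := B.swap.exists_fixed_test hI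
  refine ⟨r, hr, fun b hb a ha => ?_⟩
  obtain ⟨n, hn, hle, c, hone, hzero⟩ := h b hb a ha
  simp only [swap_avgLLR, le_neg (b := B.avgLLR n _), neg_le (a := B.avgLLR n _)] at hone hzero
  exact (Nat.cast_le.2 (B.nStar_le hn (fixedOK_of_measure_le hzero hone))).trans hle

lemma nStar_spec {a b : ℝ} (ha : a ∈ Set.Ioo (0 : ℝ) 1)
    (hb : b ∈ Set.Ioo (0 : ℝ) 1) :
    1 ≤ B.nStar a b ∧ ∃ c, B.FixedOK a b (B.nStar a b) c := by
  obtain ⟨r, -, h⟩ := B.exists_fixed_test ⟨half_pos B.info_pos, half_lt_self B.info_pos⟩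
  obtain ⟨n, hn, -, c, hzero, hone⟩ := h a ha b hb
  exact Nat.sInf_mem (s := {n | 1 ≤ n ∧ ∃ c, B.FixedOK a b n c})
    ⟨n, hn, c, fixedOK_of_measure_le hzero hone⟩

lemma bddBelow_fixedOK {a b : ℝ} (ha : a < 1) (n : ℕ) : BddBelow {c | B.FixedOK a b n c} := by
  by_contra hunbounded
  rw [not_bddBelow_iff] at hunbounded
  have hle (k : ℕ) : B.P 0 {ω | -(k : ℝ) < B.avgLLR n ω} ≤ ENNReal.ofReal a := by
    obtain ⟨c, hc, hck⟩ := hunbounded (-k)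
    exact (measure_mono fun ω => hck.trans).trans hc.1
  have hunion := measure_iUnion_lt_le (fun i j hij => neg_le_neg (Nat.cast_le.2 hij)) hle
  have huniv : (⋃ k : ℕ, {ω | -(k : ℝ) < B.avgLLR n ω}) = Set.univ := by
    refine Set.eq_univ_of_forall fun ω => Set.mem_iUnion.2 ?_
    exact (exists_nat_gt (-B.avgLLR n ω)).imp fun _ => neg_lt.1
  rw [huniv, measure_univ, ENNReal.one_le_ofReal] at hunion
  exact hunion.not_gt ha

lemma fixedOK_cStar {a b : ℝ} (ha : a ∈ Set.Ioo (0 : ℝ) 1)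
    (hb : b ∈ Set.Ioo (0 : ℝ) 1) :
    B.FixedOK a b (B.nStar a b) (B.cStar a b) := by
  obtain ⟨c, hc⟩ := (B.nStar_spec ha hb).2
  constructor
  · have hle (k : ℕ) : B.P 0 {ω | B.cStar a b + 1 / ((k : ℝ) + 1) < B.avgLLR (B.nStar a b) ω} ≤
        ENNReal.ofReal a := by
      obtain ⟨c', hc', hlt⟩ := exists_lt_of_csInf_lt ⟨c, hc⟩
        (lt_add_of_pos_right (B.cStar a b) (Nat.one_div_pos_of_nat (α := ℝ) (n := k)))
      exact (measure_mono fun ω => hlt.trans).trans hc'.1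
    refine (measure_mono fun ω hω => Set.mem_iUnion.2 ?_).trans (measure_iUnion_lt_le
      (fun i j hij => add_le_add_right (Nat.one_div_le_one_div hij) _) hle)
    obtain ⟨k, hk⟩ := exists_nat_one_div_lt
      (sub_pos.2 (show B.cStar a b < B.avgLLR (B.nStar a b) ω from hω))
    exact ⟨k, lt_sub_iff_add_lt'.1 hk⟩
  · have hbdd := B.bddBelow_fixedOK (b := b) ha.2 (B.nStar a b)
    exact (measure_mono fun ω hω => hω.trans (csInf_le hbdd hc)).trans hc.2

end BinaryProblem

/-! ### The General Multistage Test -/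

lemma div_four_mem_Ioo {x : ℝ} (hx : x ∈ Set.Ioo (0 : ℝ) 1) : x / 4 ∈ Set.Ioo (0 : ℝ) 1 :=
  ⟨div_pos hx.1 four_pos, by linarith [hx.2]⟩

lemma div_four_pow_mem_Ioo {x : ℝ} (hx : x ∈ Set.Ioo (0 : ℝ) 1) {j : ℕ} (hj : j ≠ 0) :
    (x / 4) ^ j ∈ Set.Ioo (0 : ℝ) 1 :=
  have h := div_four_mem_Ioo hx
  ⟨pow_pos h.1 j, pow_lt_one₀ h.1.le h.2 hj⟩

lemma sum_Icc_pow_le {y : ℝ} (h0 : 0 ≤ y) (h1 : y < 1) (K : ℕ) :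
    ∑ k ∈ Finset.Icc 1 K, y ^ k ≤ y / (1 - y) := by
  have h := geom_sum_Ico_le_of_lt_one (m := 1) (n := K + 1) h0 h1
  rwa [pow_one, Finset.Ico_add_one_right_eq_Icc] at h

lemma div_four_le_activeErr_zero {x : ℝ} (hx : x ∈ Set.Ioo (0 : ℝ) 1) (K : ℕ) :
    x / 4 ≤ activeErr x K 0 := by
  have hmem := div_four_mem_Ioo hx
  have hsum := sum_Icc_pow_le hmem.1.le hmem.2 K
  have hgeom : x / 4 / (1 - x / 4) ≤ x / 2 := by
    rw [div_le_iff₀ (sub_pos.2 hmem.2)]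
    nlinarith [hx.1, hx.2]
  rw [activeErr, if_pos rfl]
  linarith

lemma activeErr_mem_Ioo {x : ℝ} (hx : x ∈ Set.Ioo (0 : ℝ) 1) (K j : ℕ) :
    activeErr x K j ∈ Set.Ioo (0 : ℝ) 1 := by
  rcases eq_or_ne j 0 with rfl | hj
  · refine ⟨(div_four_mem_Ioo hx).1.trans_le (div_four_le_activeErr_zero hx K), ?_⟩
    have hsum : 0 ≤ ∑ k ∈ Finset.Icc 1 K, (x / 4) ^ k :=
      Finset.sum_nonneg fun k _ => pow_nonneg (div_four_mem_Ioo hx).1.le _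
    rw [activeErr, if_pos rfl]
    linarith [hx.2]
  · rw [activeErr, if_neg hj]
    exact div_four_pow_mem_Ioo hx hj

lemma inactiveErr_mem_Ioo {γ x : ℝ} (hγ : γ ∈ Set.Ioo (0 : ℝ) 1) (hx : x ∈ Set.Ioo (0 : ℝ) 1)
    (j : ℕ) : inactiveErr γ x j ∈ Set.Ioo (0 : ℝ) 1 := by
  rw [inactiveErr]
  split_ifs with hj
  · exact hγ
  · exact div_four_pow_mem_Ioo hx hj

lemma sum_activeErr (x : ℝ) (K : ℕ) :
    ∑ j ∈ Finset.range (K + 1), activeErr x K j = 3 * x / 4 := by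
  have hpos : ∑ j ∈ Finset.Icc 1 K, activeErr x K j = ∑ j ∈ Finset.Icc 1 K, (x / 4) ^ j :=
    Finset.sum_congr rfl fun j hj => if_neg (Nat.one_le_iff_ne_zero.1 (Finset.mem_Icc.1 hj).1)
  rw [Finset.range_eq_Ico, Finset.sum_eq_sum_Ico_succ_bot K.succ_pos, zero_add,
    Nat.succ_eq_add_one, Finset.Ico_add_one_right_eq_Icc, hpos, activeErr, if_pos rfl,
    sub_add_cancel]

lemma ofReal_div_four_add_sum_activeErr {x : ℝ} (hx : x ∈ Set.Ioo (0 : ℝ) 1) (K : ℕ) :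
    ENNReal.ofReal (x / 4) + ∑ j ∈ Finset.range (K + 1), ENNReal.ofReal (activeErr x K j) =
      ENNReal.ofReal x := by
  have hx4 := (div_four_mem_Ioo hx).1.le
  rw [← ENNReal.ofReal_sum_of_nonneg fun j _ => (activeErr_mem_Ioo hx K j).1.le, sum_activeErr,
    ← ENNReal.ofReal_add hx4 (by linarith)]
  congr 1
  ring

lemma le_sum_stages {T L K : ℕ} {N : ℕ → ℕ} {S : ℕ → Prop} [DecidablePred S]
    (hS : ∀ j ≤ K, ¬S j → T ≤ N j) (hT : T ≤ L) :
    T ≤ N 0 + ∑ j ∈ Finset.Icc 1 K, (if S (j - 1) then N j else 0) + if S K then L else 0 := by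
  induction K with
  | zero =>
    by_cases h : S 0
    · simp only [h, if_true]
      omega
    · exact (hS 0 le_rfl h).trans (by omega)
  | succ K ih =>
    have hprev := ih fun j hj => hS j (hj.trans K.le_succ)
    have hnext := hS (K + 1) le_rfl
    rw [Finset.sum_Icc_succ_top K.succ_pos, Nat.add_sub_cancel]
    by_cases h : S K <;> by_cases h' : S (K + 1) <;>
      simp only [h, h', if_true, if_false, not_false_eq_true, forall_const] at hprev hnext ⊢ <;>
      omega

lemma lintegral_stages_le {Ω : Type*} [MeasurableSpace Ω] (μ : Measure Ω) [IsProbabilityMeasure μ]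
    {T : Ω → ℕ} {L K : ℕ} {N : ℕ → ℕ} {S : ℕ → Set Ω} (hm : ∀ j, MeasurableSet (S j))
    (hS : ∀ j ≤ K, ∀ ω ∉ S j, T ω ≤ N j) (hT : ∀ ω, T ω ≤ L) :
    ∫⁻ ω, T ω ∂μ ≤ N 0 + ∑ j ∈ Finset.Icc 1 K, N j * μ (S (j - 1)) + L * μ (S K) := by
  classical
  have hpointwise (ω : Ω) : (T ω : ℝ≥0∞) ≤
      N 0 + ∑ j ∈ Finset.Icc 1 K, (S (j - 1)).indicator (fun _ => (N j : ℝ≥0∞)) ω +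
        (S K).indicator (fun _ => (L : ℝ≥0∞)) ω := by
    have h := le_sum_stages (S := fun j => ω ∈ S j) (fun j hj h => hS j hj ω h) (hT ω)
    simp only [Set.indicator_apply]
    exact_mod_cast h
  have hind (j : ℕ) (c : ℝ≥0∞) : Measurable ((S j).indicator fun _ => c) :=
    measurable_const.indicator (hm j)
  refine (lintegral_mono hpointwise).trans_eq ?_
  rw [lintegral_add_right _ (hind K _), lintegral_add_left measurable_const,
    lintegral_finsetSum _ fun j _ => hind (j - 1) _, lintegral_const, measure_univ, mul_one,
    lintegral_indicator_const (hm K)]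
  simp only [lintegral_indicator_const (hm _)]

lemma lintegral_stages_le_ofReal {Ω : Type*} [MeasurableSpace Ω] (μ : Measure Ω)
    [IsProbabilityMeasure μ] {T : Ω → ℕ} {L K : ℕ} {N : ℕ → ℕ} {S : ℕ → Set Ω} {g : ℕ → ℝ}
    (hm : ∀ j, MeasurableSet (S j)) (hS : ∀ j ≤ K, ∀ ω ∉ S j, T ω ≤ N j) (hT : ∀ ω, T ω ≤ L)
    (hg : ∀ j, 0 ≤ g j) (hμ : ∀ j, μ (S j) ≤ ENNReal.ofReal (g j)) :
    ∫⁻ ω, ((T ω : ℕ∞) : ℝ≥0∞) ∂μ ≤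
      ENNReal.ofReal (N 0 + ∑ j ∈ Finset.Icc 1 K, N j * g (j - 1) + L * g K) := by
  have hmul (n j : ℕ) : ENNReal.ofReal (n * g j) = n * ENNReal.ofReal (g j) := by
    rw [ENNReal.ofReal_mul n.cast_nonneg, ENNReal.ofReal_natCast]
  have hnonneg (n j : ℕ) : 0 ≤ n * g j := mul_nonneg n.cast_nonneg (hg j)
  have hsum : 0 ≤ ∑ j ∈ Finset.Icc 1 K, N j * g (j - 1) :=
    Finset.sum_nonneg fun j _ => hnonneg _ _
  simp only [ENat.toENNReal_coe]
  rw [ENNReal.ofReal_add (add_nonneg (Nat.cast_nonneg _) hsum) (hnonneg _ _),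
    ENNReal.ofReal_add (Nat.cast_nonneg _) hsum, ENNReal.ofReal_natCast,
    ENNReal.ofReal_sum_of_nonneg fun j _ => hnonneg _ _]
  simp only [hmul]
  refine (lintegral_stages_le μ hm hS hT).trans ?_
  gcongr <;> exact hμ _

namespace BinaryProblem

variable {𝒳 : Type*} [MeasurableSpace 𝒳] (B : BinaryProblem 𝒳)

section Multistage

variable {B} {p : GMTParams} {ω : ℕ → 𝒳}

lemma measurableSet_gmtAccepts (p : GMTParams) (n : ℕ) :
    MeasurableSet[obsSigma 𝒳 n] {ω | B.gmtAccepts p n ω} := by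
  have hset : {ω | B.gmtAccepts p n ω} =
      ⋃ j ∈ {j | j ≤ p.K 0 ∧ p.N 0 j = n ∧ n < p.Nlast}, {ω | B.avgLLR n ω ≤ p.C 0 j} := by
    ext ω
    simp only [gmtAccepts, Set.mem_ofPred_eq, Set.mem_iUnion, exists_prop, and_assoc]
  rw [hset]
  exact .biUnion (Set.to_countable _) fun j _ =>
    measurableSet_le (B.measurable_obsSigma_avgLLR le_rfl) measurable_const

lemma measurableSet_gmtRejects (p : GMTParams) (n : ℕ) :
    MeasurableSet[obsSigma 𝒳 n] {ω | B.gmtRejects p n ω} := by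
  have hset : {ω | B.gmtRejects p n ω} =
      ⋃ j ∈ {j | j ≤ p.K 1 ∧ p.N 1 j = n ∧ n < p.Nlast}, {ω | p.C 1 j < B.avgLLR n ω} := by
    ext ω
    simp only [gmtRejects, Set.mem_ofPred_eq, Set.mem_iUnion, exists_prop, and_assoc]
  rw [hset]
  exact .biUnion (Set.to_countable _) fun j _ =>
    measurableSet_lt measurable_const (B.measurable_obsSigma_avgLLR le_rfl)

lemma gmtTime_spec (p : GMTParams) (ω : ℕ → 𝒳) : B.gmtAccepts p (B.gmtTime p ω) ω ∨
    B.gmtRejects p (B.gmtTime p ω) ω ∨ B.gmtTime p ω = p.Nlast :=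
  Nat.sInf_mem (s := {n : ℕ | B.gmtAccepts p n ω ∨ B.gmtRejects p n ω ∨ n = p.Nlast})
    ⟨p.Nlast, .inr (.inr rfl)⟩

lemma gmtTime_le {n : ℕ} (h : B.gmtAccepts p n ω ∨ B.gmtRejects p n ω ∨ n = p.Nlast) :
    B.gmtTime p ω ≤ n :=
  Nat.sInf_le h

lemma gmtTime_le_Nlast (p : GMTParams) (ω : ℕ → 𝒳) : B.gmtTime p ω ≤ p.Nlast :=
  gmtTime_le (.inr (.inr rfl))

lemma gmtTime_le_of_avgLLR_le {j : ℕ} (hj : j ≤ p.K 0) (h : B.avgLLR (p.N 0 j) ω ≤ p.C 0 j) :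
    B.gmtTime p ω ≤ p.N 0 j := by
  rcases lt_or_ge (p.N 0 j) p.Nlast with hlt | hge
  · exact gmtTime_le (.inl ⟨j, hj, rfl, hlt, h⟩)
  · exact (gmtTime_le_Nlast p ω).trans hge

lemma gmtTime_le_of_lt_avgLLR {j : ℕ} (hj : j ≤ p.K 1) (h : p.C 1 j < B.avgLLR (p.N 1 j) ω) :
    B.gmtTime p ω ≤ p.N 1 j := by
  rcases lt_or_ge (p.N 1 j) p.Nlast with hlt | hge
  · exact gmtTime_le (.inr (.inl ⟨j, hj, rfl, hlt, h⟩))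
  · exact (gmtTime_le_Nlast p ω).trans hge

lemma one_le_gmtTime (hN : ∀ i, ∀ j ≤ p.K i, 1 ≤ p.N i j) (hlast : 1 ≤ p.Nlast) (ω : ℕ → 𝒳) :
    1 ≤ B.gmtTime p ω := by
  rcases B.gmtTime_spec p ω with ⟨j, hj, h, -⟩ | ⟨j, hj, h, -⟩ | h
  · exact (hN 0 j hj).trans_eq h
  · exact (hN 1 j hj).trans_eq h
  · exact hlast.trans_eq h.symm

lemma isStoppingTime_gmtTime (p : GMTParams) :
    IsStoppingTime (obsFiltration 𝒳) fun ω => (B.gmtTime p ω : ℕ∞) := by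
  intro n
  have hset : {ω : ℕ → 𝒳 | (B.gmtTime p ω : ℕ∞) ≤ n} = ⋃ k ∈ Set.Iic n,
      {ω | B.gmtAccepts p k ω} ∪ ({ω | B.gmtRejects p k ω} ∪ {_ω | k = p.Nlast}) := by
    ext ω
    simp only [Set.mem_ofPred_eq, Nat.cast_le, Set.mem_iUnion, Set.mem_union, Set.mem_Iic,
      exists_prop]
    exact ⟨fun h => ⟨_, h, B.gmtTime_spec p ω⟩, fun ⟨k, hk, h⟩ => (gmtTime_le h).trans hk⟩
  change MeasurableSet[obsSigma 𝒳 n] {ω : ℕ → 𝒳 | (B.gmtTime p ω : ℕ∞) ≤ n}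
  rw [hset]
  exact .biUnion (Set.to_countable _) fun k hk => obsSigma_mono hk _
    ((measurableSet_gmtAccepts p k).union ((measurableSet_gmtRejects p k).union (.const _)))

lemma gmtOf_D_eq_one_iff : (B.gmtOf p).D ω = 1 ↔ B.gmtRejects p (B.gmtTime p ω) ω ∨
    (B.gmtTime p ω = p.Nlast ∧ p.Clast < B.avgLLR p.Nlast ω) := by
  simp only [gmtOf, ite_eq_left_iff, zero_ne_one, imp_false, not_not]

lemma measurableSet_gmtOf_reject (p : GMTParams) (n : ℕ) :
    MeasurableSet[obsSigma 𝒳 n] {ω | (B.gmtOf p).T ω = n ∧ (B.gmtOf p).D ω = 1} := by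
  have hset : {ω | (B.gmtOf p).T ω = n ∧ (B.gmtOf p).D ω = 1} =
      {ω | (B.gmtTime p ω : ℕ∞) = n} ∩ ({ω | B.gmtRejects p n ω} ∪
        ({_ω | n = p.Nlast} ∩ {ω | p.Clast < B.avgLLR n ω})) := by
    ext ω
    simp only [Set.mem_ofPred_eq, gmtOf_D_eq_one_iff, Set.mem_inter_iff, Set.mem_union]
    refine and_congr_right fun h => ?_
    rw [Nat.cast_injective (R := ℕ∞) h]
    exact or_congr_right (and_congr_right fun hn => hn ▸ Iff.rfl)
  rw [hset]
  exact ((isStoppingTime_gmtTime p).measurableSet_eq n).inter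
    ((measurableSet_gmtRejects p n).union ((MeasurableSet.const _).inter
      (measurableSet_lt measurable_const (B.measurable_obsSigma_avgLLR le_rfl))))

lemma isTest_gmtOf (hN : ∀ i, ∀ j ≤ p.K i, 1 ≤ p.N i j) (hlast : 1 ≤ p.Nlast) :
    B.IsTest (B.gmtOf p) :=
  isTest_of_measurableSet_reject (fun ω => Nat.one_le_cast.2 (one_le_gmtTime hN hlast ω))
    (isStoppingTime_gmtTime p) (fun _ => .of_forall fun _ => ENat.natCast_lt_top _)
    (measurableSet_gmtOf_reject p) fun _ _ => ENat.natCast_lt_top _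

lemma P_zero_gmtOf_reject_le (p : GMTParams) : B.P 0 {ω | (B.gmtOf p).D ω = 1} ≤
    B.P 0 {ω | p.Clast < B.avgLLR p.Nlast ω} +
      ∑ j ∈ Finset.range (p.K 1 + 1), B.P 0 {ω | p.C 1 j < B.avgLLR (p.N 1 j) ω} := by
  have hsub : {ω | (B.gmtOf p).D ω = 1} ⊆ {ω | p.Clast < B.avgLLR p.Nlast ω} ∪
      ⋃ j ∈ Finset.range (p.K 1 + 1), {ω | p.C 1 j < B.avgLLR (p.N 1 j) ω} := by
    intro ω hω
    rcases gmtOf_D_eq_one_iff.1 (show (B.gmtOf p).D ω = 1 from hω) with ⟨j, hj, hN, -, h⟩ | ⟨-, h⟩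
    · rw [← hN] at h
      exact .inr (Set.mem_iUnion₂.2 ⟨j, Finset.mem_range_succ_iff.2 hj, h⟩)
    · exact .inl h
  exact (measure_mono hsub).trans ((measure_union_le _ _).trans
    (add_le_add_right (measure_biUnion_finset_le _ _) _))

lemma P_one_gmtOf_accept_le (p : GMTParams) : B.P 1 {ω | (B.gmtOf p).D ω = 0} ≤
    B.P 1 {ω | B.avgLLR p.Nlast ω ≤ p.Clast} +
      ∑ j ∈ Finset.range (p.K 0 + 1), B.P 1 {ω | B.avgLLR (p.N 0 j) ω ≤ p.C 0 j} := by
  have hsub : {ω | (B.gmtOf p).D ω = 0} ⊆ {ω | B.avgLLR p.Nlast ω ≤ p.Clast} ∪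
      ⋃ j ∈ Finset.range (p.K 0 + 1), {ω | B.avgLLR (p.N 0 j) ω ≤ p.C 0 j} := by
    intro ω hω
    have hreject : ¬(B.gmtOf p).D ω = 1 := by
      rw [show (B.gmtOf p).D ω = 0 from hω]
      exact zero_ne_one
    rw [gmtOf_D_eq_one_iff, not_or, not_and, not_lt] at hreject
    rcases B.gmtTime_spec p ω with ⟨j, hj, hN, -, h⟩ | h | h
    · rw [← hN] at h
      exact .inr (Set.mem_iUnion₂.2 ⟨j, Finset.mem_range_succ_iff.2 hj, h⟩)
    · exact absurd h hreject.1
    · exact .inl (hreject.2 h)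
  exact (measure_mono hsub).trans ((measure_union_le _ _).trans
    (add_le_add_right (measure_biUnion_finset_le _ _) _))

end Multistage

lemma gmtRange_subset_Ioo {α β : ℝ} (hα : 0 < α) (i : Fin 2) :
    gmtRange α β i ⊆ Set.Ioo (0 : ℝ) 1 := by
  have hzero := le_max_left (3 * α) β
  have hone := le_max_left α (3 * β)
  unfold gmtRange
  split_ifs <;> exact Set.Ioo_subset_Ioo_left (by linarith)

section Design

variable {α β : ℝ} {γ : Fin 2 → ℝ}

lemma gmtErr_mem_Ioo (hα : α ∈ Set.Ioo (0 : ℝ) 1) (hβ : β ∈ Set.Ioo (0 : ℝ) 1) {γ : ℝ}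
    (hγ : γ ∈ Set.Ioo (0 : ℝ) 1) (i : Fin 2) (j : ℕ) :
    (B.gmtErr α β i γ j).1 ∈ Set.Ioo (0 : ℝ) 1 ∧ (B.gmtErr α β i γ j).2 ∈ Set.Ioo (0 : ℝ) 1 := by
  unfold gmtErr
  split_ifs
  · exact ⟨inactiveErr_mem_Ioo hγ hβ j, activeErr_mem_Ioo hβ _ j⟩
  · exact ⟨activeErr_mem_Ioo hα _ j, inactiveErr_mem_Ioo hγ hα j⟩

lemma fixedOK_gmtParams (hα : α ∈ Set.Ioo (0 : ℝ) 1) (hβ : β ∈ Set.Ioo (0 : ℝ) 1)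
    (hγ : ∀ i, γ i ∈ Set.Ioo (0 : ℝ) 1) (i : Fin 2) (j : ℕ) :
    B.FixedOK (B.gmtErr α β i (γ i) j).1 (B.gmtErr α β i (γ i) j).2
      ((B.gmtParams α β γ).N i j) ((B.gmtParams α β γ).C i j) :=
  have hmem := B.gmtErr_mem_Ioo hα hβ (hγ i) i j
  B.fixedOK_cStar hmem.1 hmem.2

lemma gmtOf_gmtParams_mem_testClass (hα : α ∈ Set.Ioo (0 : ℝ) 1) (hβ : β ∈ Set.Ioo (0 : ℝ) 1)
    (hγ : ∀ i, γ i ∈ Set.Ioo (0 : ℝ) 1) : B.gmtOf (B.gmtParams α β γ) ∈ B.testClass α β := by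
  have hα4 := div_four_mem_Ioo hα
  have hβ4 := div_four_mem_Ioo hβ
  have hlast := B.fixedOK_cStar hα4 hβ4
  refine ⟨isTest_gmtOf (fun i j _ => ?_) (B.nStar_spec hα4 hβ4).1, ?_, ?_⟩
  · have hmem := B.gmtErr_mem_Ioo hα hβ (hγ i) i j
    exact (B.nStar_spec hmem.1 hmem.2).1
  · rw [← ofReal_div_four_add_sum_activeErr hα (B.gmtK α β 1)]
    exact (P_zero_gmtOf_reject_le _).trans (add_le_add hlast.1
      (Finset.sum_le_sum fun j _ => (B.fixedOK_gmtParams hα hβ hγ 1 j).1))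
  · rw [← ofReal_div_four_add_sum_activeErr hβ (B.gmtK α β 0)]
    exact (P_one_gmtOf_accept_le _).trans (add_le_add hlast.2
      (Finset.sum_le_sum fun j _ => (B.fixedOK_gmtParams hα hβ hγ 0 j).2))

lemma lintegral_gmtOf_zero_le (hα : α ∈ Set.Ioo (0 : ℝ) 1) (hβ : β ∈ Set.Ioo (0 : ℝ) 1)
    (hγ : ∀ i, γ i ∈ Set.Ioo (0 : ℝ) 1) :
    ∫⁻ ω, ((B.gmtOf (B.gmtParams α β γ)).T ω : ℝ≥0∞) ∂(B.P 0) ≤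
      ENNReal.ofReal (B.gmtBound α β 0 (γ 0)) := by
  let p := B.gmtParams α β γ
  exact lintegral_stages_le_ofReal (B.P 0) (N := p.N 0)
    (S := fun j => {ω | p.C 0 j < B.avgLLR (p.N 0 j) ω})
    (fun j => measurableSet_lt measurable_const (B.measurable_avgLLR _))
    (fun j hj ω hω => gmtTime_le_of_avgLLR_le hj (not_lt.1 hω)) (gmtTime_le_Nlast p)
    (fun j => (inactiveErr_mem_Ioo (hγ 0) hβ j).1.le)
    (fun j => (B.fixedOK_gmtParams hα hβ hγ 0 j).1)

lemma lintegral_gmtOf_one_le (hα : α ∈ Set.Ioo (0 : ℝ) 1) (hβ : β ∈ Set.Ioo (0 : ℝ) 1)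
    (hγ : ∀ i, γ i ∈ Set.Ioo (0 : ℝ) 1) :
    ∫⁻ ω, ((B.gmtOf (B.gmtParams α β γ)).T ω : ℝ≥0∞) ∂(B.P 1) ≤
      ENNReal.ofReal (B.gmtBound α β 1 (γ 1)) := by
  let p := B.gmtParams α β γ
  exact lintegral_stages_le_ofReal (B.P 1) (N := p.N 1)
    (S := fun j => {ω | B.avgLLR (p.N 1 j) ω ≤ p.C 1 j})
    (fun j => measurableSet_le (B.measurable_avgLLR _) measurable_const)
    (fun j hj ω hω => gmtTime_le_of_lt_avgLLR hj (not_le.1 hω)) (gmtTime_le_Nlast p)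
    (fun j => (inactiveErr_mem_Ioo (hγ 1) hα j).1.le)
    (fun j => (B.fixedOK_gmtParams hα hβ hγ 1 j).2)

end Design

end BinaryProblem

/-! ### Bounds on the expected sample size of the multistage test -/

lemma abs_log_le_abs_log {x y : ℝ} (hx : 0 < x) (hxy : x ≤ y) (hy : y ≤ 1) :
    |Real.log y| ≤ |Real.log x| := by
  rw [abs_of_nonpos (Real.log_nonpos (hx.le.trans hxy) hy),
    abs_of_nonpos (Real.log_nonpos hx.le (hxy.trans hy))]
  exact neg_le_neg (Real.log_le_log hx hxy)

lemma abs_log_div_four {x : ℝ} (hx : x ∈ Set.Ioo (0 : ℝ) 1) :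
    |Real.log (x / 4)| = |Real.log x| + Real.log 4 := by
  have hx4 := div_four_mem_Ioo hx
  rw [abs_of_neg (Real.log_neg hx.1 hx.2), abs_of_neg (Real.log_neg hx4.1 hx4.2),
    Real.log_div hx.1.ne' four_ne_zero]
  ring

lemma one_le_abs_log_div_four {x : ℝ} (hx : x ∈ Set.Ioo (0 : ℝ) 1) :
    1 ≤ |Real.log (x / 4)| := by
  have hlog : 1 ≤ Real.log 4 := by
    rw [Real.le_log_iff_exp_le four_pos]
    linarith [Real.exp_one_lt_d9]
  rw [abs_log_div_four hx]
  linarith [abs_nonneg (Real.log x)]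

lemma sum_mul_inactiveErr_le {x γ : ℝ} (hx : x ∈ Set.Ioo (0 : ℝ) 1) (K : ℕ) :
    ∑ j ∈ Finset.Icc 1 (K + 1), j * inactiveErr γ x (j - 1) ≤ γ + x := by
  have hpow (K : ℕ) : ∑ j ∈ Finset.Icc 1 (K + 1), j * inactiveErr γ x (j - 1) ≤
      γ + ∑ k ∈ Finset.Icc 1 K, (x / 2) ^ k := by
    induction K with
    | zero => simp [inactiveErr]
    | succ K ih =>
      have hstep : ((K + 1 + 1 : ℕ) : ℝ) * (x / 4) ^ (K + 1) ≤ (x / 2) ^ (K + 1) := by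
        rw [show x / 2 = 2 * (x / 4) by ring, mul_pow]
        exact mul_le_mul_of_nonneg_right (mod_cast Nat.lt_two_pow_self)
          (pow_nonneg (div_four_mem_Ioo hx).1.le _)
      rw [Finset.sum_Icc_succ_top (K + 1).succ_pos,
        Finset.sum_Icc_succ_top K.succ_pos fun k => _ ^ k, Nat.add_sub_cancel,
        inactiveErr.eq_1 γ x (K + 1), if_neg K.succ_ne_zero]
      linarith
  have hgeom := sum_Icc_pow_le (half_pos hx.1).le (by linarith [hx.2]) K
  have hle : x / 2 / (1 - x / 2) ≤ x := by
    rw [div_le_iff₀ (by linarith [hx.2])]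
    nlinarith [hx.1, hx.2]
  linarith [hpow K]

/-- The expected-sample-size bound of a multistage design with `K` additional opportunities, for
an arbitrary function `n` giving the sample size of a stage with given error probabilities. -/
def stageBound (n : ℝ → ℝ → ℕ) (K : ℕ) (α β γ : ℝ) : ℝ :=
  n (inactiveErr γ β 0) (activeErr β K 0) +
    ∑ j ∈ Finset.Icc 1 K,
      (n (inactiveErr γ β j) (activeErr β K j) : ℝ) * inactiveErr γ β (j - 1) +
    (n (α / 4) (β / 4) : ℝ) * inactiveErr γ β K

/-- One more opportunity, beyond the `K` additional ones, would be of no use: it would need more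
observations than the last stage or too small an error probability. -/
def StagesExhausted (n : ℝ → ℝ → ℕ) (α β : ℝ) (K : ℕ) : Prop :=
  n (α / 4) (β / 4) < n ((β / 4) ^ (K + 1)) ((β / 4) ^ (K + 1)) ∨ (β / 4) ^ (K + 1) < 3 * α / 4

namespace SteinBound

variable {n : ℝ → ℝ → ℕ} {I r : ℝ}

lemma le_mul (h : SteinBound n I r) (hI : 0 < I) (hr : 0 < r) {a b m : ℝ}
    (ha : a ∈ Set.Ioo (0 : ℝ) 1) (hb : b ∈ Set.Ioo (0 : ℝ) 1) (hm : 1 ≤ m)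
    (ham : |Real.log a| ≤ m) (hbm : |Real.log b| ≤ m) : (n a b : ℝ) ≤ (1 / I + 1 / r + 1) * m := by
  have hmI : 0 ≤ m / I := by positivity
  have hmr : 0 ≤ m / r := by positivity
  calc (n a b : ℝ) ≤ max (|Real.log b| / I) (|Real.log a| / r) + 1 := h a ha b hb
    _ ≤ max (m / I) (m / r) + 1 := by gcongr
    _ ≤ m / I + m / r + m := add_le_add (max_le_add_of_nonneg hmI hmr) hm
    _ = (1 / I + 1 / r + 1) * m := by ring

variable {α β : ℝ} {K : ℕ}

lemma pow_le (h : SteinBound n I r) (hI : 0 < I) (hr : 0 < r) (hβ : β ∈ Set.Ioo (0 : ℝ) 1)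
    {j : ℕ} (hj : 1 ≤ j) : (n ((β / 4) ^ j) ((β / 4) ^ j) : ℝ) ≤
      (1 / I + 1 / r + 1) * (j * |Real.log (β / 4)|) := by
  have hmem := div_four_pow_mem_Ioo hβ (Nat.one_le_iff_ne_zero.1 hj)
  have hlog : |Real.log ((β / 4) ^ j)| = j * |Real.log (β / 4)| := by
    rw [Real.log_pow, abs_mul, Nat.abs_cast]
  exact h.le_mul hI hr hmem hmem
    (one_le_mul_of_one_le_of_one_le (Nat.one_le_cast.2 hj) (one_le_abs_log_div_four hβ))
    hlog.le hlog.le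

lemma last_le (h : SteinBound n I r) (hI : 0 < I) (hr : 0 < r) (hα : α ∈ Set.Ioo (0 : ℝ) 1)
    (hβ : β ∈ Set.Ioo (0 : ℝ) 1) (hK : StagesExhausted n α β K) : (n (α / 4) (β / 4) : ℝ) ≤
      2 * (1 / I + 1 / r + 1) * ((K + 1 : ℕ) * |Real.log (β / 4)|) := by
  have hα4 := div_four_mem_Ioo hα
  have hβ4 := div_four_mem_Ioo hβ
  have hlog := one_le_abs_log_div_four hβ
  have hK1 : (1 : ℝ) ≤ (K + 1 : ℕ) := Nat.one_le_cast.2 K.succ_pos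
  have hm : |Real.log (β / 4)| ≤ (K + 1 : ℕ) * |Real.log (β / 4)| :=
    le_mul_of_one_le_left (abs_nonneg _) hK1
  rcases hK with hlt | hpow
  · have hnext := h.pow_le hI hr hβ K.succ_pos
    have hpos : 0 ≤ (1 / I + 1 / r + 1) * ((K + 1 : ℕ) * |Real.log (β / 4)|) := by positivity
    linarith [hpos, show (n (α / 4) (β / 4) : ℝ) ≤ _ from Nat.cast_le.2 hlt.le]
  · have hsq : (β / 4) ^ (2 * (K + 1)) ≤ α / 4 := by
      have hle : (β / 4) ^ (K + 1) ≤ 1 / 4 :=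
        (pow_le_of_le_one hβ4.1.le hβ4.2.le K.succ_ne_zero).trans (by linarith [hβ.2])
      rw [mul_comm, pow_mul, sq]
      nlinarith [pow_pos hβ4.1 (K + 1)]
    have hlogα : |Real.log (α / 4)| ≤ 2 * ((K + 1 : ℕ) * |Real.log (β / 4)|) := by
      refine (abs_log_le_abs_log (pow_pos hβ4.1 _) hsq hα4.2.le).trans_eq ?_
      rw [Real.log_pow, abs_mul, Nat.abs_cast, Nat.cast_mul, Nat.cast_ofNat, mul_assoc]
    exact (h.le_mul hI hr hα4 hβ4 (by linarith) hlogα (by linarith)).trans_eq (by ring)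

lemma first_le (h : SteinBound n I r) (hI : 0 < I) (hβ : β ∈ Set.Ioo (0 : ℝ) 1) {γ : ℝ}
    (hγ : γ ∈ Set.Ioo (0 : ℝ) 1) : (n (inactiveErr γ β 0) (activeErr β K 0) : ℝ) ≤
      max (|Real.log (β / 4)| / I) (|Real.log γ| / r) + 1 := by
  have hmem := activeErr_mem_Ioo hβ K 0
  have hlog : |Real.log (activeErr β K 0)| ≤ |Real.log (β / 4)| :=
    abs_log_le_abs_log (div_four_mem_Ioo hβ).1 (div_four_le_activeErr_zero hβ K) hmem.2.le
  refine (h _ (inactiveErr_mem_Ioo hγ hβ 0) _ hmem).trans ?_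
  rw [inactiveErr, if_pos rfl]
  gcongr

theorem stageBound_le (h : SteinBound n I r) (hI : 0 < I) (hr : 0 < r)
    (hα : α ∈ Set.Ioo (0 : ℝ) 1) (hβ : β ∈ Set.Ioo (0 : ℝ) 1) {γ : ℝ}
    (hγ : γ ∈ Set.Ioo (0 : ℝ) 1) (hK : StagesExhausted n α β K) :
    stageBound n K α β γ ≤ max (|Real.log (β / 4)| / I) (|Real.log γ| / r) + 1 +
      2 * (1 / I + 1 / r + 1) * |Real.log (β / 4)| * (γ + β) := by
  set D := 2 * (1 / I + 1 / r + 1) * |Real.log (β / 4)|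
  have hD0 : 0 ≤ D := by positivity
  have hg (j : ℕ) : 0 ≤ inactiveErr γ β j := (inactiveErr_mem_Ioo hγ hβ j).1.le
  have hmiddle : ∑ j ∈ Finset.Icc 1 K,
      (n (inactiveErr γ β j) (activeErr β K j) : ℝ) * inactiveErr γ β (j - 1) ≤
        ∑ j ∈ Finset.Icc 1 K, D * (j * inactiveErr γ β (j - 1)) := by
    refine Finset.sum_le_sum fun j hj => ?_
    have hj1 := (Finset.mem_Icc.1 hj).1
    have hpos : 0 ≤ (1 / I + 1 / r + 1) * (j * |Real.log (β / 4)|) := by positivity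
    rw [inactiveErr, activeErr, if_neg (by omega), if_neg (by omega), ← mul_assoc]
    refine mul_le_mul_of_nonneg_right ?_ (hg _)
    linarith [h.pow_le hI hr hβ hj1]
  have hend : (n (α / 4) (β / 4) : ℝ) * inactiveErr γ β K ≤
      D * ((K + 1 : ℕ) * inactiveErr γ β K) := by
    rw [← mul_assoc]
    refine mul_le_mul_of_nonneg_right ?_ (hg K)
    linarith [h.last_le hI hr hα hβ hK]
  have hsum := mul_le_mul_of_nonneg_left (sum_mul_inactiveErr_le (γ := γ) hβ K) hD0
  rw [Finset.sum_Icc_succ_top K.succ_pos, mul_add, Finset.mul_sum, Nat.add_sub_cancel] at hsum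
  rw [stageBound]
  linarith [h.first_le (K := K) hI hβ hγ]

end SteinBound

lemma tendsto_abs_log_div_four_div_abs_log :
    Tendsto (fun x : ℝ => |Real.log (x / 4)| / |Real.log x|) (𝓝[>] 0) (𝓝 1) := by
  have hlim : Tendsto (fun x : ℝ => 1 + Real.log 4 * |Real.log x|⁻¹) (𝓝[>] 0) (𝓝 1) := by
    simpa using ((tendsto_inv_atTop_zero.comp tendsto_abs_log_zero).const_mul
      (Real.log 4)).const_add 1
  refine hlim.congr' ?_
  filter_upwards [Ioo_mem_nhdsGT one_pos, tendsto_abs_log_zero.eventually_ne_atTop 0] with x hx hlog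
  rw [abs_log_div_four hx, add_div, div_self hlog, div_eq_mul_inv]

/-- The later stages cost `O((γ + β) |log β|)`, so only the first opportunity counts to first
order. -/
theorem eventually_stageBound_le {ι : Type*} {l : Filter ι} {n : ℝ → ℝ → ℕ} {I ρ : ℝ} (hI : 0 < I)
    (hn : ∀ I' ∈ Set.Ioo 0 I, ∃ r, 0 < r ∧ SteinBound n I' r) (hρ : 1 < ρ) {α β γ : ι → ℝ}
    {K : ι → ℕ} (hα : ∀ᶠ q in l, α q ∈ Set.Ioo (0 : ℝ) 1) (hβ : Tendsto β l (𝓝[>] 0))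
    (hγ : ∀ᶠ q in l, γ q ∈ Set.Ioo (0 : ℝ) 1) (hγ0 : Tendsto γ l (𝓝 0))
    (hlog : Tendsto (fun q => |Real.log (γ q)| / |Real.log (β q)|) l (𝓝 0))
    (hK : ∀ᶠ q in l, StagesExhausted n (α q) (β q) (K q)) :
    ∀ᶠ q in l, stageBound n (K q) (α q) (β q) (γ q) ≤ ρ * (|Real.log (β q)| / I) := by
  obtain ⟨I', hρI', hI'⟩ := exists_between (div_lt_self hI hρ)
  have hI'0 : 0 < I' := (div_pos hI (one_pos.trans hρ)).trans hρI'
  obtain ⟨r, hr, hstein⟩ := hn I' ⟨hI'0, hI'⟩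
  set D := 2 * (1 / I' + 1 / r + 1)
  have hL : Tendsto (fun q => |Real.log (β q)|) l atTop := tendsto_abs_log_zero.comp hβ
  have hratio := tendsto_abs_log_div_four_div_abs_log.comp hβ
  have hlim : Tendsto (fun q => max (|Real.log (β q / 4)| / |Real.log (β q)| / I')
      (|Real.log (γ q)| / |Real.log (β q)| / r) + |Real.log (β q)|⁻¹ +
        D * (|Real.log (β q / 4)| / |Real.log (β q)|) * (γ q + β q)) l (𝓝 (1 / I')) := by
    have h := (((hratio.div_const I').max (hlog.div_const r)).add
      (tendsto_inv_atTop_zero.comp hL)).add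
        ((hratio.const_mul D).mul (hγ0.add (hβ.mono_right nhdsWithin_le_nhds)))
    simpa [hI'0.le] using h
  have hlt : 1 / I' < ρ / I := by rwa [one_div_lt hI'0 (by positivity), one_div_div]
  filter_upwards [hlim.eventually_lt_const hlt, hα, hβ (Ioo_mem_nhdsGT one_pos), hγ, hK,
    hL.eventually_gt_atTop 0] with q hq hαq hβq hγq hKq hLq
  calc stageBound n (K q) (α q) (β q) (γ q)
      ≤ max (|Real.log (β q / 4)| / I') (|Real.log (γ q)| / r) + 1 +
          D * |Real.log (β q / 4)| * (γ q + β q) :=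
        hstein.stageBound_le hI'0 hr hαq hβq hγq hKq
    _ ≤ ρ / I * |Real.log (β q)| := by
        rw [← div_le_iff₀ hLq, add_div, add_div, ← max_div_div_right hLq.le]
        refine le_of_eq_of_le ?_ hq.le
        ring_nf
    _ = ρ * (|Real.log (β q)| / I) := by ring

/-! ### First-order optimality of the General Multistage Test -/

lemma succ_sSup_notMem {p : ℕ → Prop} {x y : ℝ} (hx : x ∈ Set.Ioo (0 : ℝ) 1) (hy : 0 < y) :
    ¬p (sSup {j | p j ∧ y ≤ x ^ j} + 1) ∨ x ^ (sSup {j | p j ∧ y ≤ x ^ j} + 1) < y := by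
  obtain ⟨k, hk⟩ := exists_pow_lt_of_lt_one hy hx.2
  have hbdd : BddAbove {j | p j ∧ y ≤ x ^ j} := by
    refine ⟨k, fun j ⟨_, hj⟩ => ?_⟩
    by_contra! hlt
    exact (hk.trans_le hj).not_ge (pow_le_pow_of_le_one hx.1.le hx.2.le hlt.le)
  by_contra! h
  exact (Nat.lt_succ_self _).not_ge (le_csSup hbdd h)

/-- A choice of the free parameter for `i`, at the levels `q = (α, β)`, that vanishes with the
levels but so slowly that its logarithm is negligible. -/
def slowParam (i : Fin 2) (q : ℝ × ℝ) : ℝ :=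
  max (max q.1 q.2) |Real.log (if i = 0 then q.2 else q.1)|⁻¹

lemma tendsto_abs_log_level (i : Fin 2) :
    Tendsto (fun q : ℝ × ℝ => |Real.log (if i = 0 then q.2 else q.1)|) smallLevels atTop := by
  split_ifs
  · exact tendsto_abs_log_zero.comp tendsto_snd
  · exact tendsto_abs_log_zero.comp tendsto_fst

lemma tendsto_slowParam (i : Fin 2) : Tendsto (slowParam i) smallLevels (𝓝 0) := by
  have hfst : Tendsto Prod.fst smallLevels (𝓝 (0 : ℝ)) :=
    tendsto_fst.mono_right nhdsWithin_le_nhds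
  have hsnd : Tendsto Prod.snd smallLevels (𝓝 (0 : ℝ)) :=
    tendsto_snd.mono_right nhdsWithin_le_nhds
  have hlim := (hfst.max hsnd).max (tendsto_inv_atTop_zero.comp (tendsto_abs_log_level i))
  rw [max_self, max_self] at hlim
  exact hlim

lemma eventually_slowParam_mem_gmtRange (i : Fin 2) :
    ∀ᶠ q in smallLevels, slowParam i q ∈ BinaryProblem.gmtRange q.1 q.2 i := by
  filter_upwards [eventually_mem_Ioo_smallLevels one_pos,
    (tendsto_slowParam i).eventually_lt_const one_pos] with q hq hlt
  have hα : q.1 ≤ slowParam i q := (le_max_left _ _).trans (le_max_left _ _)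
  have hβ : q.2 ≤ slowParam i q := (le_max_right _ _).trans (le_max_left _ _)
  unfold BinaryProblem.gmtRange
  split_ifs <;>
    exact ⟨(div_lt_iff₀ four_pos).2
      (max_lt (by linarith [hq.1.1, hq.2.1]) (by linarith [hq.1.1, hq.2.1])), hlt⟩

lemma tendsto_abs_log_slowParam_div (i : Fin 2) :
    Tendsto (fun q => |Real.log (slowParam i q)| / |Real.log (if i = 0 then q.2 else q.1)|)
      smallLevels (𝓝 0) := by
  have hlevel := tendsto_abs_log_level i
  have hlim := (Real.isLittleO_log_id_atTop.tendsto_div_nhds_zero).comp hlevel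
  refine squeeze_zero' (.of_forall fun q => by positivity) ?_ hlim
  filter_upwards [hlevel.eventually_gt_atTop 1,
    (tendsto_slowParam i).eventually_lt_const one_pos] with q hq hlt
  refine div_le_div_of_nonneg_right ?_ (abs_nonneg _)
  refine (abs_log_le_abs_log (inv_pos.2 (one_pos.trans hq)) (le_max_right _ _) hlt.le).trans_eq ?_
  rw [Real.log_inv, abs_neg, abs_of_pos (Real.log_pos hq)]

namespace BinaryProblem

variable {𝒳 : Type*} [MeasurableSpace 𝒳] (B : BinaryProblem 𝒳)

lemma gmtBound_zero (α β γ : ℝ) :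
    B.gmtBound α β 0 γ = stageBound B.nStar (B.gmtK α β 0) α β γ := by
  simp only [gmtBound, stageBound, gmtErr, if_true]

lemma gmtBound_one (α β γ : ℝ) : B.gmtBound α β 1 γ =
    stageBound (fun a b => B.nStar b a) (B.gmtK α β 1) β α γ := by
  simp only [gmtBound, stageBound, gmtErr, one_ne_zero, if_false]

lemma stagesExhausted_gmtK_zero {α β : ℝ} (hα : 0 < α) (hβ : β ∈ Set.Ioo (0 : ℝ) 1) :
    StagesExhausted B.nStar α β (B.gmtK α β 0) :=
  (succ_sSup_notMem (p := fun j => B.nStar ((β / 4) ^ j) ((β / 4) ^ j) ≤ B.nStar (α / 4) (β / 4))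
    (div_four_mem_Ioo hβ) (by positivity)).imp_left not_le.1

lemma stagesExhausted_gmtK_one {α β : ℝ} (hα : α ∈ Set.Ioo (0 : ℝ) 1) (hβ : 0 < β) :
    StagesExhausted (fun a b => B.nStar b a) β α (B.gmtK α β 1) :=
  (succ_sSup_notMem (p := fun j => B.nStar ((α / 4) ^ j) ((α / 4) ^ j) ≤ B.nStar (α / 4) (β / 4))
    (div_four_mem_Ioo hα) (by positivity)).imp_left not_le.1

lemma eventually_gmtBound_le (i : Fin 2) {l : Filter (ℝ × ℝ)} (hl : l ≤ smallLevels)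
    {γ : ℝ × ℝ → ℝ} (hγ : ∀ᶠ q in l, γ q ∈ Set.Ioo (0 : ℝ) 1) (hγ0 : Tendsto γ l (𝓝 0))
    (hlog : Tendsto (fun q => |Real.log (γ q)| / |Real.log (if i = 0 then q.2 else q.1)|) l (𝓝 0))
    {ρ : ℝ} (hρ : 1 < ρ) :
    ∀ᶠ q in l, B.gmtBound q.1 q.2 i (γ q) ≤ ρ * B.firstOrderESS q i := by
  have hmem : ∀ᶠ q in l, q.1 ∈ Set.Ioo (0 : ℝ) 1 ∧ q.2 ∈ Set.Ioo (0 : ℝ) 1 :=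
    hl (eventually_mem_Ioo_smallLevels one_pos)
  match i with
  | 0 =>
    simp only [gmtBound_zero]
    exact eventually_stageBound_le B.info_pos (fun _ => B.exists_steinBound_nStar) hρ
      (hmem.mono fun q hq => hq.1) (tendsto_snd.mono_left hl) hγ hγ0 hlog
      (hmem.mono fun q hq => B.stagesExhausted_gmtK_zero hq.1.1 hq.2)
  | 1 =>
    simp only [gmtBound_one]
    exact eventually_stageBound_le B.swap.info_pos (fun _ => B.exists_steinBound_nStar_swap) hρ
      (hmem.mono fun q hq => hq.2) (tendsto_fst.mono_left hl) hγ hγ0 hlog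
      (hmem.mono fun q hq => B.stagesExhausted_gmtK_one hq.1 hq.2.1)

variable {B}

lemma GMTSelection.eventually_gmtBound_le {i : Fin 2} {γ : ℝ → ℝ → ℝ} (hγ : B.GMTSelection i γ)
    {ρ : ℝ} (hρ : 1 < ρ) :
    ∀ᶠ q in smallLevels, B.gmtBound q.1 q.2 i (γ q.1 q.2) ≤ ρ * B.firstOrderESS q i := by
  obtain ⟨hrange, hγ0, hlog⟩ := hγ
  have hmem := eventually_mem_Ioo_smallLevels one_pos
  have hslow : ∀ᶠ q in smallLevels,
      B.gmtBound q.1 q.2 i (slowParam i q) ≤ ρ * B.firstOrderESS q i :=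
    B.eventually_gmtBound_le i le_rfl
      ((hmem.and (eventually_slowParam_mem_gmtRange i)).mono
        fun q hq => gmtRange_subset_Ioo hq.1.1.1 i hq.2)
      (tendsto_slowParam i) (tendsto_abs_log_slowParam_div i) hρ
  have hnonMin := eventually_inf_principal.1 (B.eventually_gmtBound_le i
    (inf_le_left (b := 𝓟 (B.gmtNonMin i γ)))
    ((hmem.filter_mono inf_le_left).mono
      fun q hq => gmtRange_subset_Ioo hq.1.1 i (hrange _ hq.1 _ hq.2)) hγ0 hlog hρ)
  filter_upwards [hslow, hnonMin, eventually_slowParam_mem_gmtRange i] with q hq hqNonMin hqRange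
  by_cases hmin : IsMinOn (B.gmtBound q.1 q.2 i) (gmtRange q.1 q.2 i) (γ q.1 q.2)
  · exact (hmin hqRange).trans hq
  · exact hqNonMin hmin

lemma GMTSelection.mem_Ioo {i : Fin 2} {γ : ℝ → ℝ → ℝ} (hγ : B.GMTSelection i γ) {α β : ℝ}
    (hα : α ∈ Set.Ioo (0 : ℝ) 1) (hβ : β ∈ Set.Ioo (0 : ℝ) 1) : γ α β ∈ Set.Ioo (0 : ℝ) 1 :=
  gmtRange_subset_Ioo hα.1 i (hγ.1 α hα β hβ)

variable {γ : Fin 2 → ℝ → ℝ → ℝ}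

theorem gmt_mem_testClass (hγ : ∀ i, B.GMTSelection i (γ i)) {α β : ℝ}
    (hα : α ∈ Set.Ioo (0 : ℝ) 1) (hβ : β ∈ Set.Ioo (0 : ℝ) 1) :
    B.gmt γ α β ∈ B.testClass α β :=
  B.gmtOf_gmtParams_mem_testClass hα hβ fun i => (hγ i).mem_Ioo hα hβ

theorem firstOrderOptimal_gmt (hγ : ∀ i, B.GMTSelection i (γ i)) :
    B.FirstOrderOptimal (B.gmt γ) := by
  intro i ρ hρ
  filter_upwards [eventually_mem_Ioo_smallLevels one_pos, (hγ i).eventually_gmtBound_le hρ]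
    with q ⟨hα, hβ⟩ hbound
  have hmem (i : Fin 2) := (hγ i).mem_Ioo hα hβ
  refine le_trans ?_ (ENNReal.ofReal_le_ofReal hbound)
  match i with
  | 0 => exact B.lintegral_gmtOf_zero_le hα hβ hmem
  | 1 => exact B.lintegral_gmtOf_one_le hα hβ hmem

end BinaryProblem

end

theorem mainTheorem3 {𝒳 : Type*} [MeasurableSpace 𝒳] (B : BinaryProblem 𝒳) (l u : ℕ → ℕ)
    (hlu : ∀ m : ℕ, 1 ≤ m → l m ≤ u m ∧ u m ≤ m ∧ 0 < u m ∧ l m < m)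
    (hu : Tendsto u atTop atTop) (hl : Tendsto (fun m : ℕ => m - l m) atTop atTop) :
    (∀ m : ℕ, 1 ≤ m →
      (∀ α ∈ Set.Ioo (0 : ℝ) 1, ∀ β ∈ Set.Ioo (0 : ℝ) 1,
        B.fweClass m (l m) (u m) α β = B.testClass (levelI m (l m) α) (levelII (u m) β)) ∧
      ∀ (τ : TestRule 𝒳), B.IsTest τ → ∀ A : Finset (Fin m),
        B.avgESS A τ = B.ess ((A.card : ℝ) / m) τ) ∧
    B.HighDimOptimal l u B.sprt ∧
    ∀ γ : Fin 2 → ℝ → ℝ → ℝ, (∀ i, B.GMTSelection i (γ i)) →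
      B.HighDimOptimal l u (B.gmt γ) := by
  have hle : ∀ᶠ m in atTop, l m ≤ u m := (eventually_ge_atTop 1).mono fun m hm => (hlu m hm).1
  refine ⟨fun m hm => ⟨fun α hα β hβ => ?_, fun τ hτ A => hτ.avgESS_eq_ess hm A⟩, ?_,
    fun γ hγ => ?_⟩
  · obtain ⟨hlu', hum, hu0, hlm⟩ := hlu m hm
    exact B.fweClass_eq_testClass hlu' hum hu0 hlm hα hβ
  · exact B.firstOrderOptimal_sprt.highDimOptimal
      (fun α hα β hβ => B.sprt_mem_testClass hα hβ) hle hu hl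
  · exact (BinaryProblem.firstOrderOptimal_gmt hγ).highDimOptimal
      (fun α hα β hβ => BinaryProblem.gmt_mem_testClass hγ hα hβ) hle hu hl
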